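/- **Setting.** Finitely many closed squares $\alpha_1,\dots,\alpha_M$ in the plane (the *prototiles*; equal or congruent squares are allowed and are distinguished by their index) are given. A *tile* of form $\alpha_i$ is a translate $\alpha_i+v$, $v\in\mathbb R^2$, together with the index $i$. A *tiling* is a set of tiles such that distinct tiles have no common interior point; it is a *tiling of the plane* if its tiles cover $\mathbb R^2$; it is *side-to-side* if any two sides of distinct tiles of it that share a segment of positive length coincide. A *substitution* $\tau$ consists of a real number $\theta>1$ and, for each $i$, a finite tiling $\mathcal M_i$ of the stretched prototile $\theta\alpha_i$. The *decomposition* $\tau\mathcal T$ of a tiling $\mathcal T$ is obtained by replacing every tile $\alpha_i+v$ of $\mathcal T$ by $\mathcal M_i+\theta v$; then $\mathcal T$ is called a *composition* of $\tau\mathcal T$. A *supertile* is a set of tiles obtained from a single tile by finitely many decompositions. - A tiling $\mathcal T$ of the plane is *hierarchical* if there is an infinite sequence of side-to-side tilings $\mathcal T_0=\mathcal T,\mathcal T_1,\mathcal T_2,\dots$ such that $\mathcal T_{n+1}$ is a composition of $\mathcal T_n$ for all $n\ge 0$. - A tiling $\mathcal T$ of the plane is a *substitution tiling* if every finite subset of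 $\mathcal T$ is included in some supertile. - A *decorated prototile* is a prototile together with a colouring of its four sides by colours from a finite set; a prototile may be decorated in several ways, or in none. Tilings with decorated tiles are defined as above, and such a tiling of the plane is *proper* if it is side-to-side and the two colours of every side shared by two of its tiles are equal. A family $\mathcal F$ of tilings of the plane is *sofic* if there are a finite set of colours and a set of decorated prototiles such that a tiling $\mathcal T$ belongs to $\mathcal F$ if and only if $\mathcal T$ is obtained, by erasing the colours, from a proper tiling of the plane with decorated tiles from that set. **Theorem.** Let $\tau$ be a substitution all of whose prototiles are squares of the same size. Then (a) the family of hierarchical tilings for $\tau$ is sofic, and (b) the family of substitution tilings for $\tau$ is sofic. -/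

import Mathlib

namespace SquareTiling

/-- A (closed, nondegenerate) square in the Euclidean plane, the plane being identified with `ℂ`.
Its vertices are `corner`, `corner + edge`, `corner + (1 + i) edge`, `corner + i edge`.
Each square of the plane has exactly one side vector `edge` (counterclockwise direction) whose
argument lies in `[0, π/2)`; this is the one recorded, so every square, whatever its position,
size and orientation, is described by exactly one term of this type. -/
structure Square where
  corner : ℂ
  edge : ℂ
  edge_re_pos : 0 < edge.re
  edge_im_nonneg : 0 ≤ edge.im

namespace Square

/-- The set of points of the square. -/
def region (Q : Square) : Set ℂ :=
  (fun z : ℂ => Q.corner + Q.edge * z) '' (Set.Icc (0 : ℝ) 1 ×ℂ Set.Icc (0 : ℝ) 1)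

/-- The four vertices in counterclockwise order (the index is cyclic). -/
noncomputable def vertex (Q : Square) (j : Fin 4) : ℂ :=
  Q.corner + Q.edge * (![0, 1, 1 + Complex.I, Complex.I] : Fin 4 → ℂ) j

/-- The four sides. -/
def side (Q : Square) (j : Fin 4) : Set ℂ :=
  segment ℝ (Q.vertex j) (Q.vertex (j + 1))

noncomputable def sideLength (Q : Square) : ℝ := ‖Q.edge‖

/-- The translate of a square by the vector `v`. -/
noncomputable def shift (Q : Square) (v : ℂ) : Square :=
  { Q with corner := Q.corner + v }

end Square

/-! ### Tilings

Prototiles are given by a family `α : κ → Square`; the index of a prototile is its colour (its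
"form"), so different prototiles may be equal or congruent as squares. -/

/-- A tile is a shift of a prototile: `(i, v)` is the prototile `i` shifted by `v`. -/
abbrev Tile (κ : Type*) := κ × ℂ

section Tilings

variable {κ : Type*} (α : κ → Square)

/-- The square occupied by a tile. -/
noncomputable def place (t : Tile κ) : Square := (α t.1).shift t.2

/-- A tiling is a set of tiles such that distinct tiles have no common interior point. -/
def IsTiling (T : Set (Tile κ)) : Prop :=
  T.Pairwise fun s t =>
    Disjoint (interior (place α s).region) (interior (place α t).region)

/-- The part of the plane covered by a set of tiles. -/
def support (T : Set (Tile κ)) : Set ℂ := ⋃ t ∈ T, (place α t).region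

/-- A tiling of the plane. -/
def IsPlaneTiling (T : Set (Tile κ)) : Prop :=
  IsTiling α T ∧ support α T = Set.univ

/-- Sides of distinct tiles which share a fragment of positive length coincide. (The intersection
of two sides is convex, so it contains a segment of positive length iff it has two points.) -/
def SideToSide (T : Set (Tile κ)) : Prop :=
  ∀ s ∈ T, ∀ t ∈ T, s ≠ t → ∀ j k : Fin 4,
    ((place α s).side j ∩ (place α t).side k).Nontrivial →
      (place α s).side j = (place α t).side k

end Tilings

/-! ### Sofic families -/

/-- A decoration of a prototile by colours from `C` assigns a colour to each of its four sides;
a decorated prototile is a prototile with a decoration. -/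
abbrev Decorated (ι C : Type*) := ι × (Fin 4 → C)

/-- The square underlying a decorated prototile. -/
def decoratedSquare {ι : Type*} (α : ι → Square) (C : Type*) (d : Decorated ι C) : Square :=
  α d.1

/-- Erasing the colours of the sides. -/
def eraseColours {ι C : Type*} (t : Tile (Decorated ι C)) : Tile ι := (t.1.1, t.2)

/-- A proper tiling of the plane with the decorated prototiles from `D`: it is side-to-side, and
the colours of a side shared by two tiles match. -/
structure IsProper {ι C : Type*} (α : ι → Square) (D : Set (Decorated ι C))
    (T : Set (Tile (Decorated ι C))) : Prop where
  allowed : ∀ t ∈ T, t.1 ∈ D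
  planeTiling : IsPlaneTiling (decoratedSquare α C) T
  sideToSide : SideToSide (decoratedSquare α C) T
  colours_match : ∀ s ∈ T, ∀ t ∈ T, s ≠ t → ∀ j k : Fin 4,
    (place (decoratedSquare α C) s).side j = (place (decoratedSquare α C) t).side k →
      s.1.2 j = t.1.2 k

/-- A family `F` of tilings of the plane is sofic if, for some finite set of colours and some set
of decorated prototiles, its members are exactly the projections of the proper tilings. -/
def IsSofic {ι : Type*} (α : ι → Square) (F : Set (Set (Tile ι))) : Prop :=
  ∃ (C : Type) (_ : Finite C) (D : Set (Decorated ι C)),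
    ∀ T : Set (Tile ι),
      T ∈ F ↔ ∃ T' : Set (Tile (Decorated ι C)), IsProper α D T' ∧ eraseColours '' T' = T

/-! ### Substitutions -/

/-- A substitution: square prototiles, a stretching factor `θ > 1`, and for each prototile `i` a
rule, that is, a finite tiling of the stretched prototile `θ α i`. -/
structure Substitution (ι : Type*) where
  prototile : ι → Square
  factor : ℝ
  one_lt_factor : 1 < factor
  rule : ι → Set (Tile ι)
  rule_finite : ∀ i, (rule i).Finite
  rule_isTiling : ∀ i, IsTiling prototile (rule i)
  rule_support : ∀ i, support prototile (rule i) =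
    (fun z : ℂ => (factor : ℂ) * z) '' (prototile i).region

namespace Substitution

variable {ι : Type*} (σ : Substitution ι)

/-- The decomposition of a set of tiles: every tile `(i, v)` is replaced by the tiling `rule i`
shifted by `θ v`, which is a tiling of the stretched tile `θ (α i + v)`. -/
def decompose (T : Set (Tile ι)) : Set (Tile ι) :=
  {t | ∃ p ∈ T, ∃ q ∈ σ.rule p.1, t = (q.1, q.2 + (σ.factor : ℂ) * p.2)}

/-- `S` is a supertile (of any order): it is obtained from one tile by several decompositions. -/
def IsSupertile (S : Set (Tile ι)) : Prop :=
  ∃ (n : ℕ) (t : Tile ι), S = σ.decompose^[n] {t}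

/-- A substitution tiling: a tiling of the plane each finite part of which is included in some
supertile. -/
def IsSubstitutionTiling (T : Set (Tile ι)) : Prop :=
  IsPlaneTiling σ.prototile T ∧
    ∀ F : Set (Tile ι), F ⊆ T → F.Finite → ∃ S, σ.IsSupertile S ∧ F ⊆ S

/-- A hierarchical tiling: a tiling `T` of the plane with an infinite sequence
`T = 𝒯 0, 𝒯 1, 𝒯 2, …` of side-to-side tilings such that each `𝒯 (n + 1)` is a composition of
`𝒯 n`. -/
def IsHierarchical (T : Set (Tile ι)) : Prop :=
  IsPlaneTiling σ.prototile T ∧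
    ∃ 𝒯 : ℕ → Set (Tile ι), 𝒯 0 = T ∧
      ∀ n, IsTiling σ.prototile (𝒯 n) ∧ SideToSide σ.prototile (𝒯 n) ∧
        σ.decompose (𝒯 (n + 1)) = 𝒯 n

end Substitution

end SquareTiling

namespace SquareTiling

/-! Geometry disappears first. In a side-to-side tiling of the plane by congruent squares every side
is shared with a neighbour, so the tiles form a square lattice (`IsPlaneTiling.exists_grid`). Each
rule also fills a lattice square, so the factor is an integer `k` and the substitution replaces a
label by a `k × k` array of labels (`Substitution.exists_isLattice`). Hierarchical tilings become
label fields on `ℤ × ℤ` with an infinite chain of compositions (`HasHierarchy`). A rule relating a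
cell to its left and lower neighbours can be expressed by side colours (`isSofic_of_localRule`), so
what remains is to enforce an infinite hierarchy by such a rule with finitely many symbols.

A row has level `n` if it runs along the bottoms of blocks of order `n` but not of order `n + 1`;
columns likewise. Through each block of order `n` such a line carries the address of that block: its
position in its parent, the position of the parent, and the label of the grandparent. Blocks of
different orders are thus served by different lines, and each line carries bounded information.
Where lines of equal level cross, their addresses agree. Otherwise the line of higher level passes
unchanged, and if its level is higher by exactly one, it must carry the address of the parent
(`Crossing`). Crossings never mention the level itself. Hence the blocks of a valid field, with the
lines through their lower left corners, form a valid field again (`IsValid.blockField_isValid`), and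
iteration yields compositions of all orders. Conversely, the lines of a given hierarchy obey the
rule (`hierarchyCell_isValid`).

For substitution tilings a hierarchy is not enough: blocks of every order may meet in a way that no
supertile shows. But a bounded window meets at most `2 × 2` blocks of a large order, so it suffices
that all `2 × 2` patterns of blocks are legal. These patterns are finitely many labels with a
substitution of their own, so (b) becomes a statement about hierarchies with adjacency relations
(`isSubstitutive_iff`). The converse direction there needs a compactness argument to find
substitutive compositions (`IsSubstitutive.exists_composition`). -/

/-- The position `(i, j)` of a block in its parent, the position `(i', j')` of the parent in the
grandparent, and the label `c` of the grandparent. -/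
@[ext]
structure Address (k : ℕ) (A : Type*) where
  i : ZMod k
  j : ZMod k
  i' : ZMod k
  j' : ZMod k
  c : A

instance {k : ℕ} [NeZero k] {A : Type*} [Finite A] : Finite (Address k A) :=
  Finite.of_injective (fun I : Address k A => (I.i, I.j, I.i', I.j', I.c)) fun I J h => by
    simp only [Prod.mk.injEq] at h
    ext <;> tauto

/-- The symbol of a cell: its position in its block, the label `B` of the block, and the addresses
carried by the row (`e`) and the column (`n`) through the cell. -/
@[ext]
structure Cell (k : ℕ) (A : Type*) where
  i : ZMod k
  j : ZMod k
  B : A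
  e : Address k A
  n : Address k A

instance {k : ℕ} [NeZero k] {A : Type*} [Finite A] : Finite (Cell k A) :=
  Finite.of_injective (fun I : Cell k A => (I.i, I.j, I.B, I.e, I.n)) fun I J h => by
    simp only [Prod.mk.injEq] at h
    ext1 <;> tauto

/-! ### The local rule for cells and the hierarchies it is to enforce. -/

section Wires

variable {k : ℕ} {A : Type*} (S : A → ZMod k → ZMod k → A) (relH relV : A → A → Prop)

/-- The label of the parent block. -/
def Address.parent (I : Address k A) : A := S I.c I.i' I.j'

/-- The label of a cell. -/
def Cell.form (s : Cell k A) : A := S s.B s.i s.j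

/-- `I` is the address of the right neighbour of the block with address `L`. -/
structure HStep (L I : Address k A) : Prop where
  i : I.i = L.i + 1
  j : I.j = L.j
  j' : I.j' = L.j'
  inner : I.i ≠ 0 → I.i' = L.i' ∧ I.c = L.c
  outer : I.i = 0 → I.i' = L.i' + 1
  label : I.i = 0 → I.i' ≠ 0 → I.c = L.c
  border : I.i = 0 → I.i' = 0 → relH L.c I.c

/-- `I` is the address of the upper neighbour of the block with address `L`. -/
structure VStep (L I : Address k A) : Prop where
  j : I.j = L.j + 1
  i : I.i = L.i
  i' : I.i' = L.i'
  inner : I.j ≠ 0 → I.j' = L.j' ∧ I.c = L.c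
  outer : I.j = 0 → I.j' = L.j' + 1
  label : I.j = 0 → I.j' ≠ 0 → I.c = L.c
  border : I.j = 0 → I.j' = 0 → relV L.c I.c

/-- `K` is the address of the parent of a block with address `I`. -/
structure Above (I K : Address k A) : Prop where
  i : K.i = I.i'
  j : K.j = I.j'
  parent : K.parent S = I.c

/-- The crossing of a row and a column: both have the same level, or one of them, of a higher
level, is not affected by the other one. -/
def Crossing (w e s n : Address k A) : Prop :=
  (e = n ∧ e.i ≠ 0 ∧ e.j ≠ 0 ∧ HStep relH w e ∧ VStep relV s n) ∨
  (s = n ∧ HStep relH w e ∧ e.i = 0 ∧ e.j ≠ 0 ∧ (e.i' ≠ 0 → Above S e n)) ∨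
  (w = e ∧ VStep relV s n ∧ n.i ≠ 0 ∧ n.j = 0 ∧ (n.j' ≠ 0 → Above S n e)) ∨
  (w = e ∧ s = n)

/-- The local rule for a cell `s` with left neighbour `l` and lower neighbour `d`. -/
structure LocalRule (l d s : Cell k A) : Prop where
  hi : s.i = l.i + 1
  hj : s.j = l.j
  vi : s.i = d.i
  vj : s.j = d.j + 1
  hB : s.i ≠ 0 → s.B = l.B
  vB : s.j ≠ 0 → s.B = d.B
  hrel : s.i = 0 → relH l.B s.B
  vrel : s.j = 0 → relV d.B s.B
  row : s.j ≠ 0 → s.e.i = s.i ∧ s.e.j = s.j ∧ s.e.parent S = s.B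
  col : s.i ≠ 0 → s.n.i = s.i ∧ s.n.j = s.j ∧ s.n.parent S = s.B
  crossing : Crossing S relH relV l.e s.e d.n s.n

/-- A field of cells obeying the local rule everywhere. -/
def IsValid (σ : ℤ → ℤ → Cell k A) : Prop :=
  ∀ x y, LocalRule S relH relV (σ (x - 1) y) (σ x (y - 1)) (σ x y)

/-- `f` is obtained from `g` by substitution and a translation. -/
def IsComposition (g f : ℤ → ℤ → A) (p q : ℤ) : Prop :=
  ∀ x y, f x y = S (g ((x + p) / k) ((y + q) / k)) ((x + p : ℤ) : ZMod k) ((y + q : ℤ) : ZMod k)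

/-- `f` has an infinite hierarchy of compositions, the labels of which obey the adjacency relations
`relH` and `relV`. -/
def HasHierarchy (f : ℤ → ℤ → A) : Prop :=
  ∃ (F : ℕ → ℤ → ℤ → A) (p q : ℕ → ℤ), F 0 = f ∧
    (∀ n, IsComposition S (F (n + 1)) (F n) (p n) (q n)) ∧
    ∀ n x y, relH (F (n + 1) x y) (F (n + 1) (x + 1) y) ∧
      relV (F (n + 1) x y) (F (n + 1) x (y + 1))

end Wires

set_option linter.unusedSectionVars false

/-! ### Division by `k`: crossing block boundaries. -/

section Blocks

variable {k : ℕ} [Fact (1 < k)]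

lemma ediv_sub_one_of_ne_zero {x : ℤ} (h : (x : ZMod k) ≠ 0) : (x - 1) / (k : ℤ) = x / k := by
  have hk : (0 : ℤ) < k := by exact_mod_cast lt_trans one_pos (Fact.out : 1 < k)
  have h1 : x % k ≠ 0 := fun h2 =>
    h ((ZMod.intCast_zmod_eq_zero_iff_dvd x k).2 (Int.dvd_of_emod_eq_zero h2))
  have h2 := Int.emod_nonneg x hk.ne'
  have h3 := Int.emod_lt_of_pos x hk
  have h4 := Int.mul_ediv_add_emod x k
  rw [Int.ediv_eq_iff_of_pos hk, mul_comm]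
  constructor <;> omega

lemma ediv_sub_one_of_eq_zero {x : ℤ} (h : (x : ZMod k) = 0) :
    (x - 1) / (k : ℤ) = x / k - 1 := by
  have hk : (0 : ℤ) < k := by exact_mod_cast lt_trans one_pos (Fact.out : 1 < k)
  obtain ⟨y, rfl⟩ := (ZMod.intCast_zmod_eq_zero_iff_dvd x k).1 h
  rw [Int.mul_ediv_cancel_left _ hk.ne', Int.ediv_eq_iff_of_pos hk]
  constructor <;> linarith [mul_comm (k : ℤ) y, sub_mul y 1 (k : ℤ)]

/-- Propagation from the first position of a block: a quantity that changes only at block boundaries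
is constant on blocks. -/
lemma eq_blockStart {β : Type*} {p : ℤ} {h : ℤ → β}
    (H : ∀ x, ((x + p : ℤ) : ZMod k) ≠ 0 → h x = h (x - 1)) (x : ℤ) :
    h x = h (k * ((x + p) / k) - p) := by
  have hk : (0 : ℤ) < k := by exact_mod_cast lt_trans one_pos (Fact.out : 1 < k)
  generalize hX : (x + p) / (k : ℤ) = X
  have key : ∀ a : ℕ, a < k → h (k * X - p + a) = h (k * X - p) := by
    intro a
    induction a with
    | zero => simp
    | succ a ih =>
      intro ha
      rw [H, ← ih (by omega)]
      · congr 1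
        push_cast
        ring
      · have : (k * X - p + ((a + 1 : ℕ) : ℤ) + p : ℤ) = k * X + ((a + 1 : ℕ) : ℤ) := by ring
        rw [this]
        push_cast
        rw [ZMod.natCast_self, zero_mul, zero_add]
        have h0 : ((a + 1 : ℕ) : ZMod k) ≠ 0 := fun h0 => by
          rw [ZMod.natCast_eq_zero_iff] at h0
          exact absurd (Nat.le_of_dvd (Nat.succ_pos a) h0) (by omega)
        exact_mod_cast h0
  have h2 := Int.emod_nonneg (x + p) hk.ne'
  have h3 := Int.emod_lt_of_pos (x + p) hk
  have h4 := Int.mul_ediv_add_emod (x + p) k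
  rw [hX] at h4
  have := key ((x + p) % k).toNat (by omega)
  rw [← this]
  congr 1
  rw [Int.toNat_of_nonneg h2]
  linarith

lemma blockStart_ediv (X p : ℤ) : (k * X - p + p) / (k : ℤ) = X := by
  have hk : (0 : ℤ) < k := by exact_mod_cast lt_trans one_pos (Fact.out : 1 < k)
  rw [sub_add_cancel, Int.mul_ediv_cancel_left _ hk.ne']

lemma eq_apply_zero {β : Type*} {h : ℤ → β} (H : ∀ x, h x = h (x - 1)) (x : ℤ) : h x = h 0 := by
  induction x with
  | zero => rfl
  | succ n ih => rw [H, add_sub_cancel_right, ih]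
  | pred n ih => rw [← H, ih]

end Blocks

/-! ### From the local rule to a hierarchy. -/

/-- The part of an address which is common to all cells of a block. -/
def Address.key {k : ℕ} {A : Type*} (I : Address k A) : ZMod k × ZMod k × A := (I.i', I.j', I.c)

open Classical in
/-- The address of the block of a cell, as known to the rows and columns of lowest level. -/
noncomputable def blockKey {k : ℕ} {A : Type*} (σ : ℤ → ℤ → Cell k A) (x y : ℤ) :
    ZMod k × ZMod k × A :=
  if (σ x y).j ≠ 0 then (σ x y).e.key
  else if (σ x y).i ≠ 0 then (σ x y).n.key else (σ (x + 1) y).n.key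

/-- The field of the blocks of a field of cells. -/
noncomputable def blockField {k : ℕ} {A : Type*} (σ : ℤ → ℤ → Cell k A) (p q X Y : ℤ) : Cell k A :=
  let x := k * X - p
  let y := k * Y - q
  ⟨(blockKey σ x y).1, (blockKey σ x y).2.1, (blockKey σ x y).2.2, (σ x y).e, (σ x y).n⟩

section Soundness

variable {k : ℕ} [Fact (1 < k)] {A : Type*} {S : A → ZMod k → ZMod k → A} {relH relV : A → A → Prop}
  {σ : ℤ → ℤ → Cell k A}

lemma IsValid.exists_offset (hσ : IsValid S relH relV σ) :
    ∃ p q : ℤ, (∀ x y, (σ x y).i = ((x + p : ℤ) : ZMod k)) ∧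
      ∀ x y, (σ x y).j = ((y + q : ℤ) : ZMod k) := by
  obtain ⟨p, hp⟩ := ZMod.intCast_surjective (σ 0 0).i
  obtain ⟨q, hq⟩ := ZMod.intCast_surjective (σ 0 0).j
  refine ⟨p, q, fun x y => ?_, fun x y => ?_⟩
  · have h1 := eq_apply_zero (h := fun y => (σ x y).i) (fun y => (hσ x y).vi) y
    have h2 := eq_apply_zero (h := fun x => (σ x 0).i - (x : ZMod k))
      (fun x => by rw [(hσ x 0).hi]; push_cast; ring) x
    simp only [Int.cast_zero, sub_zero] at h1 h2
    rw [h1, sub_eq_iff_eq_add.1 h2, ← hp]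
    push_cast
    ring
  · have h1 := eq_apply_zero (h := fun x => (σ x y).j) (fun x => (hσ x y).hj) x
    have h2 := eq_apply_zero (h := fun y => (σ 0 y).j - (y : ZMod k))
      (fun y => by rw [(hσ 0 y).vj]; push_cast; ring) y
    simp only [Int.cast_zero, sub_zero] at h1 h2
    rw [h1, sub_eq_iff_eq_add.1 h2, ← hq]
    push_cast
    ring

/-- A row of lowest level shows the horizontal position of the cell, which changes modulo `k > 1` at
each step. This excludes the crossings at which the row passes unchanged. -/
lemma IsValid.row_ne (hσ : IsValid S relH relV σ) {x y : ℤ} (hy : (σ x y).j ≠ 0) :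
    (σ (x - 1) y).e ≠ (σ x y).e := fun h => by
  have h1 := ((hσ (x - 1) y).row (by rwa [← (hσ x y).hj])).1
  have h2 := ((hσ x y).row hy).1
  rw [h, h2, (hσ x y).hi] at h1
  simp at h1

lemma IsValid.col_ne (hσ : IsValid S relH relV σ) {x y : ℤ} (hx : (σ x y).i ≠ 0) :
    (σ x (y - 1)).n ≠ (σ x y).n := fun h => by
  have h1 := ((hσ x (y - 1)).col (by rwa [← (hσ x y).vi])).2.1
  have h2 := ((hσ x y).col hx).2.1
  rw [h, h2, (hσ x y).vj] at h1
  simp at h1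

/-- In this and the next two lemmas the position of the cell in its block decides which clause of
`Crossing` applies: here both lines have lowest level, in `left` only the row, in `bottom` only the
column. A corner cell, with both positions zero, remains undetermined; its crossing belongs to the
higher orders. -/
lemma IsValid.inner (hσ : IsValid S relH relV σ) {x y : ℤ} (hx : (σ x y).i ≠ 0)
    (hy : (σ x y).j ≠ 0) : (σ x y).e = (σ x y).n ∧ HStep relH (σ (x - 1) y).e (σ x y).e ∧
      VStep relV (σ x (y - 1)).n (σ x y).n := by
  rcases (hσ x y).crossing with h | h | h | h
  · exact ⟨h.1, h.2.2.2⟩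
  · exact absurd h.1 (hσ.col_ne hx)
  · exact absurd h.1 (hσ.row_ne hy)
  · exact absurd h.1 (hσ.row_ne hy)

lemma IsValid.left (hσ : IsValid S relH relV σ) {x y : ℤ} (hx : (σ x y).i = 0)
    (hy : (σ x y).j ≠ 0) : (σ x (y - 1)).n = (σ x y).n ∧ HStep relH (σ (x - 1) y).e (σ x y).e ∧
      ((σ x y).e.i' ≠ 0 → Above S (σ x y).e (σ x y).n) := by
  rcases (hσ x y).crossing with h | h | h | h
  · exact absurd (((hσ x y).row hy).1.trans hx) h.2.1
  · exact ⟨h.1, h.2.1, h.2.2.2.2⟩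
  · exact absurd h.1 (hσ.row_ne hy)
  · exact absurd h.1 (hσ.row_ne hy)

lemma IsValid.bottom (hσ : IsValid S relH relV σ) {x y : ℤ} (hx : (σ x y).i ≠ 0)
    (hy : (σ x y).j = 0) : (σ (x - 1) y).e = (σ x y).e ∧ VStep relV (σ x (y - 1)).n (σ x y).n ∧
      ((σ x y).n.j' ≠ 0 → Above S (σ x y).n (σ x y).e) := by
  rcases (hσ x y).crossing with h | h | h | h
  · have := ((hσ x y).col hx).2.1
    rw [← h.1, hy] at this
    exact absurd this h.2.2.1
  · exact absurd h.1 (hσ.col_ne hx)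
  · exact ⟨h.1, h.2.1, h.2.2.2.2⟩
  · exact absurd h.2 (hσ.col_ne hx)

lemma HStep.key_eq {L I : Address k A} (h : HStep relH L I) (hi : I.i ≠ 0) : I.key = L.key := by
  simp [Address.key, h.inner hi, h.j']

lemma VStep.key_eq {L I : Address k A} (h : VStep relV L I) (hj : I.j ≠ 0) : I.key = L.key := by
  simp [Address.key, h.inner hj, h.i']

lemma IsValid.i_succ (hσ : IsValid S relH relV σ) (x y : ℤ) : (σ (x + 1) y).i = (σ x y).i + 1 := by
  rw [(hσ (x + 1) y).hi, add_sub_cancel_right]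

lemma IsValid.j_succ (hσ : IsValid S relH relV σ) (x y : ℤ) : (σ (x + 1) y).j = (σ x y).j := by
  rw [(hσ (x + 1) y).hj, add_sub_cancel_right]

lemma IsValid.i_up (hσ : IsValid S relH relV σ) (x y : ℤ) : (σ x (y + 1)).i = (σ x y).i := by
  rw [(hσ x (y + 1)).vi, add_sub_cancel_right]

lemma IsValid.j_up (hσ : IsValid S relH relV σ) (x y : ℤ) : (σ x (y + 1)).j = (σ x y).j + 1 := by
  rw [(hσ x (y + 1)).vj, add_sub_cancel_right]

/-- Columns of lowest level know the key of the block. -/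
lemma IsValid.blockKey_of_i_ne (hσ : IsValid S relH relV σ) {x y : ℤ} (hx : (σ x y).i ≠ 0) :
    blockKey σ x y = (σ x y).n.key := by
  unfold blockKey
  split_ifs with hy
  · rw [(hσ.inner hx hy).1]
  · rfl

lemma IsValid.blockKey_of_j_ne {x y : ℤ} (hy : (σ x y).j ≠ 0) :
    blockKey σ x y = (σ x y).e.key := if_pos hy

/-- Justifies reading the key of a corner cell, which lies on no line of lowest level, from the
column to its right. -/
lemma IsValid.blockKey_succ (hσ : IsValid S relH relV σ) {x y : ℤ} (hx : (σ x y).i = 0) :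
    blockKey σ (x + 1) y = blockKey σ x y := by
  have hx' : (σ (x + 1) y).i ≠ 0 := by rw [hσ.i_succ, hx]; simp
  by_cases hy : (σ x y).j = 0
  · rw [hσ.blockKey_of_i_ne hx']
    simp [blockKey, hx, hy]
  · have hy' : (σ (x + 1) y).j ≠ 0 := by rwa [hσ.j_succ]
    have h1 := (hσ.inner hx' hy').2.1
    rw [add_sub_cancel_right] at h1
    rw [IsValid.blockKey_of_j_ne hy, IsValid.blockKey_of_j_ne hy', h1.key_eq]
    rw [((hσ _ _).row hy').1]
    exact hx'

/-- Inside a block the columns of lowest level transport the key vertically. The leftmost column has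
a higher level and borrows the key from the column to its right. -/
lemma IsValid.blockKey_v (hσ : IsValid S relH relV σ) {x y : ℤ} (hy : (σ x y).j ≠ 0) :
    blockKey σ x y = blockKey σ x (y - 1) := by
  have main : ∀ x, (σ x y).i ≠ 0 → (σ x y).j ≠ 0 → blockKey σ x y = blockKey σ x (y - 1) := by
    intro x hx hy
    rw [hσ.blockKey_of_i_ne hx, hσ.blockKey_of_i_ne (by rwa [← (hσ x y).vi]),
      (hσ.inner hx hy).2.2.key_eq]
    rw [((hσ _ _).col hx).2.1]
    exact hy
  by_cases hx : (σ x y).i = 0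
  · rw [← hσ.blockKey_succ hx, ← hσ.blockKey_succ (y := y - 1) (by rwa [← (hσ x y).vi])]
    refine main _ ?_ (by rwa [hσ.j_succ])
    rw [hσ.i_succ, hx]
    simp
  · exact main x hx hy

lemma IsValid.blockKey_h (hσ : IsValid S relH relV σ) {x y : ℤ} (hx : (σ x y).i ≠ 0) :
    blockKey σ x y = blockKey σ (x - 1) y := by
  have main : ∀ y, (σ x y).i ≠ 0 → (σ x y).j ≠ 0 → blockKey σ x y = blockKey σ (x - 1) y := by
    intro y hx hy
    rw [IsValid.blockKey_of_j_ne hy, IsValid.blockKey_of_j_ne (by rwa [← (hσ x y).hj]),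
      (hσ.inner hx hy).2.1.key_eq]
    rw [((hσ _ _).row hy).1]
    exact hx
  by_cases hy : (σ x y).j = 0
  · have hy' : (σ x (y + 1)).j ≠ 0 := by rw [hσ.j_up, hy]; simp
    have h1 := hσ.blockKey_v hy'
    have h2 := hσ.blockKey_v (x := x - 1) (y := y + 1) (by rwa [← (hσ x _).hj])
    rw [add_sub_cancel_right] at h1 h2
    rw [← h1, ← h2]
    exact main _ (by rwa [hσ.i_up]) hy'
  · exact main y hx hy

/-- The label of a block is the one determined by its address. -/
lemma IsValid.B_eq (hσ : IsValid S relH relV σ) (x y : ℤ) :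
    (σ x y).B = S (blockKey σ x y).2.2 (blockKey σ x y).1 (blockKey σ x y).2.1 := by
  have main : ∀ x, (σ x y).i ≠ 0 →
      (σ x y).B = S (blockKey σ x y).2.2 (blockKey σ x y).1 (blockKey σ x y).2.1 := by
    intro x hx
    rw [hσ.blockKey_of_i_ne hx, ← ((hσ x y).col hx).2.2]
    rfl
  by_cases hx : (σ x y).i = 0
  · have hx' : (σ (x + 1) y).i ≠ 0 := by rw [hσ.i_succ, hx]; simp
    rw [← hσ.blockKey_succ hx, ← main _ hx', (hσ _ _).hB hx', add_sub_cancel_right]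
  · exact main x hx

/-- The self-similarity of the local rule. The key of a block supplies the position and label of the
corresponding cell one order up. Its conditions on neighbours are the `HStep` and `VStep` conditions
at block boundaries, read off just above and just right of the corner. -/
lemma IsValid.blockField_isValid (hσ : IsValid S relH relV σ) {p q : ℤ}
    (hp : ∀ x y, (σ x y).i = ((x + p : ℤ) : ZMod k))
    (hq : ∀ x y, (σ x y).j = ((y + q : ℤ) : ZMod k)) :
    IsValid S relH relV (blockField σ p q) := by
  have keyH : ∀ x y, blockKey σ x y = blockKey σ (k * ((x + p) / k) - p) y := fun x y =>
    eq_blockStart (h := fun x => blockKey σ x y) (fun x hx => hσ.blockKey_h (by rwa [hp])) x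
  have keyV : ∀ x y, blockKey σ x y = blockKey σ x (k * ((y + q) / k) - q) := fun x y =>
    eq_blockStart (h := fun y => blockKey σ x y) (fun y hy => hσ.blockKey_v (by rwa [hq])) y
  intro X Y
  set x := (k : ℤ) * X - p with hx
  set y := (k : ℤ) * Y - q with hy
  have hx0 : (σ x y).i = 0 := by rw [hp, hx]; simp
  have hy0 : (σ x y).j = 0 := by rw [hq, hy]; simp
  have eX : (x - 1 + p) / (k : ℤ) = X - 1 := by
    have : ((x + p : ℤ) : ZMod k) = 0 := by rw [← hp x y, hx0]
    have := ediv_sub_one_of_eq_zero this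
    rw [blockStart_ediv] at this
    rw [← this]
    congr 1
    ring
  have eY : (y - 1 + q) / (k : ℤ) = Y - 1 := by
    have : ((y + q : ℤ) : ZMod k) = 0 := by rw [← hq x y, hy0]
    have := ediv_sub_one_of_eq_zero this
    rw [blockStart_ediv] at this
    rw [← this]
    congr 1
    ring
  have kW : blockKey σ (x - 1) y = blockKey σ (k * (X - 1) - p) y := by rw [keyH, eX]
  have kD : blockKey σ x (y - 1) = blockKey σ x (k * (Y - 1) - q) := by rw [keyV, eY]
  -- The bottom row of a block is not affected by the columns of lowest level that it crosses, so
  -- what arrives at a corner from the left is what left the corner of the previous block.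
  have wE : (σ (x - 1) y).e = (σ (k * (X - 1) - p) y).e := by
    rw [← eX]
    refine eq_blockStart (h := fun x => (σ x y).e) (fun x' hx' => ?_) _
    exact (hσ.bottom (by rwa [hp]) (by rwa [hq, ← hq x])).1.symm
  have sN : (σ x (y - 1)).n = (σ x (k * (Y - 1) - q)).n := by
    rw [← eY]
    refine eq_blockStart (h := fun y => (σ x y).n) (fun y' hy' => ?_) _
    exact (hσ.left (by rwa [hp, ← hp x y]) (by rwa [hq])).1.symm
  -- the row above the lower left corner
  have hxu : (σ x (y + 1)).i = 0 := by rw [hσ.i_up, hx0]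
  have hyu : (σ x (y + 1)).j ≠ 0 := by rw [hσ.j_up, hy0]; simp
  have up := hσ.left hxu hyu
  have kup : (σ x (y + 1)).e.key = blockKey σ x y := by
    rw [← IsValid.blockKey_of_j_ne hyu, hσ.blockKey_v hyu, add_sub_cancel_right]
  have kupW : (σ (x - 1) (y + 1)).e.key = blockKey σ (x - 1) y := by
    have h : (σ (x - 1) (y + 1)).j ≠ 0 := by rwa [← (hσ x _).hj]
    rw [← IsValid.blockKey_of_j_ne h, hσ.blockKey_v h, add_sub_cancel_right]
  -- the column to the right of it
  have hxr : (σ (x + 1) y).i ≠ 0 := by rw [hσ.i_succ, hx0]; simp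
  have hyr : (σ (x + 1) y).j = 0 := by rw [hσ.j_succ, hy0]
  have rt := hσ.bottom hxr hyr
  have krt : (σ (x + 1) y).n.key = blockKey σ x y := by
    rw [← hσ.blockKey_of_i_ne hxr, hσ.blockKey_h hxr, add_sub_cancel_right]
  have krtD : (σ (x + 1) (y - 1)).n.key = blockKey σ x (y - 1) := by
    have h : (σ (x + 1) (y - 1)).i ≠ 0 := by rwa [← (hσ _ y).vi]
    rw [← hσ.blockKey_of_i_ne h, hσ.blockKey_h h, add_sub_cancel_right]
  have iup : (σ x (y + 1)).e.i = 0 := ((hσ _ _).row hyu).1.trans hxu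
  have jrt : (σ (x + 1) y).n.j = 0 := ((hσ _ _).col hxr).2.1.trans hyr
  rw [add_sub_cancel_right] at rt up
  have H := up.2.1
  have V := rt.2.1
  rw [kW] at kupW
  rw [kD] at krtD
  simp only [Address.key, Prod.ext_iff] at kup kupW krt krtD
  -- The clauses `Above` tie lowest-level lines to lines of the next level; they yield the rules
  -- `row` (from `A2`) and `col` (from `A1`) for the block.
  have A1 := up.2.2
  have A2 := rt.2.2
  rw [← up.1] at A1
  rw [← rt.1] at A2
  constructor
  · simpa only [blockField, ← hx, ← hy, kup, kupW] using H.outer iup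
  · simpa only [blockField, ← hx, ← hy, kup, kupW] using H.j'
  · simpa only [blockField, ← hx, ← hy, krt, krtD] using V.i'
  · simpa only [blockField, ← hx, ← hy, krt, krtD] using V.outer jrt
  · simpa only [blockField, ← hx, ← hy, kup, kupW] using H.label iup
  · simpa only [blockField, ← hx, ← hy, krt, krtD] using V.label jrt
  · simpa only [blockField, ← hx, ← hy, kup, kupW] using H.border iup
  · simpa only [blockField, ← hx, ← hy, krt, krtD] using V.border jrt
  · intro h
    simp only [blockField, ← hx, ← hy, ← krt.1, ← krt.2.1, ← krt.2.2] at h ⊢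
    exact ⟨(A2 h).i, (A2 h).j, (A2 h).parent⟩
  · intro h
    simp only [blockField, ← hx, ← hy, ← kup.1, ← kup.2.1, ← kup.2.2] at h ⊢
    exact ⟨(A1 h).i, (A1 h).j, (A1 h).parent⟩
  -- The crossing at the corner cell is literally the crossing of the block, since the incoming
  -- lines cross the neighbouring blocks unchanged.
  · have := (hσ x y).crossing
    rwa [wE, sN] at this

lemma IsValid.B_eq_form (hσ : IsValid S relH relV σ) {p q : ℤ}
    (hp : ∀ x y, (σ x y).i = ((x + p : ℤ) : ZMod k))
    (hq : ∀ x y, (σ x y).j = ((y + q : ℤ) : ZMod k)) (x y : ℤ) :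
    (σ x y).B = (blockField σ p q ((x + p) / k) ((y + q) / k)).form S := by
  have keyH : ∀ x y, blockKey σ x y = blockKey σ (k * ((x + p) / k) - p) y := fun x y =>
    eq_blockStart (h := fun x => blockKey σ x y) (fun x hx => hσ.blockKey_h (by rwa [hp])) x
  have keyV : ∀ x y, blockKey σ x y = blockKey σ x (k * ((y + q) / k) - q) := fun x y =>
    eq_blockStart (h := fun y => blockKey σ x y) (fun y hy => hσ.blockKey_v (by rwa [hq])) y
  rw [hσ.B_eq, keyH, keyV]
  rfl

/-- Passing to the field of blocks preserves validity, so it can be iterated; the labels of the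
iterates are the successive compositions. -/
theorem IsValid.hasHierarchy (hσ : IsValid S relH relV σ) :
    HasHierarchy S relH relV (fun x y => (σ x y).form S) := by
  have step : ∀ σ : {σ : ℤ → ℤ → Cell k A // IsValid S relH relV σ},
      ∃ (σ' : {σ : ℤ → ℤ → Cell k A // IsValid S relH relV σ}) (p q : ℤ),
        IsComposition S (fun x y => (σ'.1 x y).form S) (fun x y => (σ.1 x y).form S) p q ∧
        ∀ X Y, relH ((σ'.1 X Y).form S) ((σ'.1 (X + 1) Y).form S) ∧
          relV ((σ'.1 X Y).form S) ((σ'.1 X (Y + 1)).form S) := by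
    rintro ⟨σ, hσ⟩
    obtain ⟨p, q, hp, hq⟩ := hσ.exists_offset
    refine ⟨⟨_, hσ.blockField_isValid hp hq⟩, p, q, fun x y => ?_, fun X Y => ?_⟩
    · simp only [← hp x y, ← hq x y]
      rw [← hσ.B_eq_form hp hq]
      rfl
    · have e1 : ∀ X p : ℤ, (k * (X + 1) - p - 1 + p) / (k : ℤ) = X := fun X p => by
        have := ediv_sub_one_of_eq_zero (k := k) (x := k * (X + 1) - p + p) (by simp)
        rw [blockStart_ediv, add_sub_cancel_right] at this
        rwa [sub_right_comm, sub_add_cancel, ← sub_add_cancel ((k : ℤ) * (X + 1)) p]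
      constructor
      · have := (hσ (k * (X + 1) - p) (k * Y - q)).hrel (by rw [hp]; simp)
        rwa [hσ.B_eq_form hp hq, hσ.B_eq_form hp hq, blockStart_ediv, blockStart_ediv, e1] at this
      · have := (hσ (k * X - p) (k * (Y + 1) - q)).vrel (by rw [hq]; simp)
        rwa [hσ.B_eq_form hp hq, hσ.B_eq_form hp hq, blockStart_ediv, blockStart_ediv, e1] at this
  choose next p q hc hr using step
  let seq : ℕ → {σ : ℤ → ℤ → Cell k A // IsValid S relH relV σ} := fun n => next^[n] ⟨σ, hσ⟩
  have hseq : ∀ n, seq (n + 1) = next (seq n) := fun n => Function.iterate_succ_apply' _ _ _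
  refine ⟨fun n x y => ((seq n).1 x y).form S, fun n => p (seq n), fun n => q (seq n), rfl,
    fun n => ?_, fun n => ?_⟩
  · simp only [hseq]
    exact hc _
  · simp only [hseq]
    exact hr _

end Soundness

/-! ### From a hierarchy to a field obeying the local rule. -/

section Completeness

variable {k : ℕ} [Fact (1 < k)] {A : Type*} {S : A → ZMod k → ZMod k → A} {relH relV : A → A → Prop}

/-- The index of the block of order `n` containing the position `x`. -/
def blockIndex (k : ℕ) (p : ℕ → ℤ) : ℕ → ℤ → ℤ
  | 0, x => x
  | n + 1, x => (blockIndex k p n x + p n) / k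

/-- The position, in its parent, of the block of order `n` containing the position `x`. -/
def digit (k : ℕ) (p : ℕ → ℤ) (n : ℕ) (x : ℤ) : ZMod k := ((blockIndex k p n x + p n : ℤ) : ZMod k)

/-- The position `x` is a block boundary of order `n` and of no higher order. -/
def IsLevel (k : ℕ) (p : ℕ → ℤ) (x : ℤ) (n : ℕ) : Prop :=
  (∀ m < n, digit k p m x = 0) ∧ digit k p n x ≠ 0

/-- The second alternative is a fault line, a boundary of blocks of every order. -/
lemma exists_isLevel_or (k : ℕ) (p : ℕ → ℤ) (x : ℤ) :
    (∃ n, IsLevel k p x n) ∨ ∀ n, digit k p n x = 0 := by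
  classical
  by_cases h : ∃ n, digit k p n x ≠ 0
  · exact Or.inl ⟨Nat.find h, fun m hm => not_not.1 (Nat.find_min h hm), Nat.find_spec h⟩
  · push Not at h
    exact Or.inr h

lemma IsLevel.unique {p : ℕ → ℤ} {x : ℤ} {m n : ℕ} (hm : IsLevel k p x m) (hn : IsLevel k p x n) :
    m = n := by
  rcases lt_trichotomy m n with h | h | h
  · exact absurd (hn.1 m h) hm.2
  · exact h
  · exact absurd (hm.1 n h) hn.2

lemma blockIndex_sub_one_of_eq_zero {p : ℕ → ℤ} {x : ℤ} :
    ∀ {n : ℕ}, (∀ m < n, digit k p m x = 0) → blockIndex k p n (x - 1) = blockIndex k p n x - 1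
  | 0, _ => rfl
  | n + 1, h => by
    have ih := blockIndex_sub_one_of_eq_zero fun m hm => h m (Nat.lt_succ_of_lt hm)
    have h0 := ediv_sub_one_of_eq_zero (h n (Nat.lt_succ_self n))
    rw [blockIndex, blockIndex, ← h0, ih]
    congr 1
    ring

/-- A boundary of level `n` is interior to a block of order `n + 1`, hence to one block of each
higher order. -/
lemma IsLevel.blockIndex_sub_one {p : ℕ → ℤ} {x : ℤ} {n : ℕ} (h : IsLevel k p x n) :
    ∀ m, n < m → blockIndex k p m (x - 1) = blockIndex k p m x := by
  refine Nat.le_induction ?_ ?_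
  · have h0 := ediv_sub_one_of_ne_zero h.2
    rw [blockIndex, blockIndex, ← h0, blockIndex_sub_one_of_eq_zero h.1]
    congr 1
    ring
  · intro m _ ih
    rw [blockIndex, blockIndex, ih]

variable (F : ℕ → ℤ → ℤ → A) (p q : ℕ → ℤ)

/-- The address of the block of order `n` containing the cell `(x, y)`. -/
def address (k : ℕ) (n : ℕ) (x y : ℤ) : Address k A :=
  ⟨digit k p n x, digit k q n y, digit k p (n + 1) x, digit k q (n + 1) y,
    F (n + 2) (blockIndex k p (n + 2) x) (blockIndex k q (n + 2) y)⟩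

open Classical in
/-- The address carried by a row. -/
noncomputable def rowAddress (k : ℕ) (x y : ℤ) : Address k A :=
  if h : ∃ n, IsLevel k q y n then address F p q k h.choose x y else address F p q k 0 0 0

open Classical in
/-- The address carried by a column. -/
noncomputable def colAddress (k : ℕ) (x y : ℤ) : Address k A :=
  if h : ∃ n, IsLevel k p x n then address F p q k h.choose x y else address F p q k 0 0 0

/-- The cells for a field with a hierarchy. -/
noncomputable def hierarchyCell (k : ℕ) (x y : ℤ) : Cell k A :=
  ⟨digit k p 0 x, digit k q 0 y, F 1 (blockIndex k p 1 x) (blockIndex k q 1 y),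
    rowAddress F p q k x y, colAddress F p q k x y⟩

variable {F p q}

lemma rowAddress_of_isLevel {n : ℕ} {y : ℤ} (h : IsLevel k q y n) (x : ℤ) :
    rowAddress F p q k x y = address F p q k n x y := by
  have h' : ∃ n, IsLevel k q y n := ⟨n, h⟩
  rw [rowAddress, dif_pos h', h'.choose_spec.unique h]

lemma colAddress_of_isLevel {n : ℕ} {x : ℤ} (h : IsLevel k p x n) (y : ℤ) :
    colAddress F p q k x y = address F p q k n x y := by
  have h' : ∃ n, IsLevel k p x n := ⟨n, h⟩
  rw [colAddress, dif_pos h', h'.choose_spec.unique h]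

/-- A fault line carries an arbitrary address; all that matters is that it is constant along the
line, so that the line passes every crossing unchanged. -/
lemma rowAddress_of_eq_zero {y : ℤ} (h : ∀ n, digit k q n y = 0) (x : ℤ) :
    rowAddress F p q k x y = address F p q k 0 0 0 :=
  dif_neg fun ⟨n, hn⟩ => hn.2 (h n)

lemma colAddress_of_eq_zero {x : ℤ} (h : ∀ n, digit k p n x = 0) (y : ℤ) :
    colAddress F p q k x y = address F p q k 0 0 0 :=
  dif_neg fun ⟨n, hn⟩ => hn.2 (h n)

lemma address_parent (hF : ∀ n, IsComposition S (F (n + 1)) (F n) (p n) (q n)) (n : ℕ) (x y : ℤ) :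
    (address F p q k n x y).parent S =
      F (n + 1) (blockIndex k p (n + 1) x) (blockIndex k q (n + 1) y) :=
  (hF (n + 1) _ _).symm

lemma digit_sub_one {x : ℤ} {n : ℕ} (h : ∀ m < n, digit k p m x = 0) :
    digit k p n x = digit k p n (x - 1) + 1 := by
  rw [digit, digit, blockIndex_sub_one_of_eq_zero h]
  push_cast
  ring

/-- The address of order `n` looks two orders up. The clauses of `HStep` distinguish whether the
step to the right stays inside the parent, leaves it inside the grandparent, or leaves the
grandparent too. -/
lemma address_hStep (hrel : ∀ n x y, relH (F (n + 1) x y) (F (n + 1) (x + 1) y)) {n : ℕ} {x : ℤ}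
    (hx : ∀ m < n, digit k p m x = 0) (y : ℤ) :
    HStep relH (address F p q k n (x - 1) y) (address F p q k n x y) := by
  have hx1 : digit k p n x = 0 → ∀ m < n + 1, digit k p m x = 0 := fun h m hm => by
    rcases Nat.lt_succ_iff_lt_or_eq.1 hm with h1 | rfl
    exacts [hx m h1, h]
  constructor
  · exact digit_sub_one hx
  · rfl
  · rfl
  · intro h
    have hl : IsLevel k p x n := ⟨hx, h⟩
    simp [address, digit, hl.blockIndex_sub_one]
  · intro h
    exact digit_sub_one (hx1 h)
  · intro h h'
    have hl : IsLevel k p x (n + 1) := ⟨hx1 h, h'⟩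
    simp [address, hl.blockIndex_sub_one]
  · intro h h'
    have := blockIndex_sub_one_of_eq_zero (k := k) (p := p) (x := x) (n := n + 2) fun m hm => by
      rcases Nat.lt_succ_iff_lt_or_eq.1 hm with h1 | rfl
      exacts [hx1 h m h1, h']
    simp only [address, this]
    have h2 := hrel (n + 1) (blockIndex k p (n + 2) x - 1) (blockIndex k q (n + 2) y)
    rwa [sub_add_cancel] at h2

lemma address_vStep (hrel : ∀ n x y, relV (F (n + 1) x y) (F (n + 1) x (y + 1))) {n : ℕ} {y : ℤ}
    (hy : ∀ m < n, digit k q m y = 0) (x : ℤ) :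
    VStep relV (address F p q k n x (y - 1)) (address F p q k n x y) := by
  have hy1 : digit k q n y = 0 → ∀ m < n + 1, digit k q m y = 0 := fun h m hm => by
    rcases Nat.lt_succ_iff_lt_or_eq.1 hm with h1 | rfl
    exacts [hy m h1, h]
  constructor
  · exact digit_sub_one hy
  · rfl
  · rfl
  · intro h
    have hl : IsLevel k q y n := ⟨hy, h⟩
    simp [address, digit, hl.blockIndex_sub_one]
  · intro h
    exact digit_sub_one (hy1 h)
  · intro h h'
    have hl : IsLevel k q y (n + 1) := ⟨hy1 h, h'⟩
    simp [address, hl.blockIndex_sub_one]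
  · intro h h'
    have := blockIndex_sub_one_of_eq_zero (k := k) (p := q) (x := y) (n := n + 2) fun m hm => by
      rcases Nat.lt_succ_iff_lt_or_eq.1 hm with h1 | rfl
      exacts [hy1 h m h1, h']
    simp only [address, this]
    have h2 := hrel (n + 1) (blockIndex k p (n + 2) x) (blockIndex k q (n + 2) y - 1)
    rwa [sub_add_cancel] at h2

lemma address_sub_one_left {n m : ℕ} {x : ℤ} (hx : IsLevel k p x n) (h : n < m) (y : ℤ) :
    address F p q k m (x - 1) y = address F p q k m x y := by
  simp [address, digit, hx.blockIndex_sub_one, h, Nat.lt_succ_of_lt h,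
    Nat.lt_succ_of_lt (Nat.lt_succ_of_lt h)]

lemma address_sub_one_right {n m : ℕ} {y : ℤ} (hy : IsLevel k q y n) (h : n < m) (x : ℤ) :
    address F p q k m x (y - 1) = address F p q k m x y := by
  simp [address, digit, hy.blockIndex_sub_one, h, Nat.lt_succ_of_lt h,
    Nat.lt_succ_of_lt (Nat.lt_succ_of_lt h)]

lemma address_above (hF : ∀ n, IsComposition S (F (n + 1)) (F n) (p n) (q n)) (n : ℕ) (x y : ℤ) :
    Above S (address F p q k n x y) (address F p q k (n + 1) x y) :=
  ⟨rfl, rfl, address_parent hF _ _ _⟩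

/-- Comparing the levels of the column and the row gives the first three clauses of `Crossing`, a
fault line counting as infinitely high. Two crossing fault lines require the fourth. -/
lemma hierarchyCell_crossing (hF : ∀ n, IsComposition S (F (n + 1)) (F n) (p n) (q n))
    (hrel : ∀ n x y, relH (F (n + 1) x y) (F (n + 1) (x + 1) y) ∧
      relV (F (n + 1) x y) (F (n + 1) x (y + 1))) (x y : ℤ) :
    Crossing S relH relV (rowAddress F p q k (x - 1) y) (rowAddress F p q k x y)
      (colAddress F p q k x (y - 1)) (colAddress F p q k x y) := by
  have hH := fun n x y => (hrel n x y).1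
  have hV := fun n x y => (hrel n x y).2
  rcases exists_isLevel_or k p x with ⟨m, hm⟩ | hx <;>
    rcases exists_isLevel_or k q y with ⟨n, hn⟩ | hy
  · simp only [rowAddress_of_isLevel hn, colAddress_of_isLevel hm]
    rcases lt_trichotomy n m with h | rfl | h
    · refine Or.inr (Or.inl ⟨address_sub_one_right hn h x,
        address_hStep hH (fun l hl => hm.1 l (hl.trans h)) y, hm.1 n h, hn.2, fun h' => ?_⟩)
      -- A nonzero position of the parent means that the column is not a boundary of order `n + 2`,
      -- so its level is exactly one above that of the row.
      have : m = n + 1 := by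
        by_contra hne
        exact h' (hm.1 (n + 1) (by omega))
      rw [this]
      exact address_above hF _ _ _
    · exact Or.inl ⟨rfl, hm.2, hn.2, address_hStep hH hm.1 y, address_vStep hV hn.1 x⟩
    · refine Or.inr (Or.inr (Or.inl ⟨address_sub_one_left hm h y,
        address_vStep hV (fun l hl => hn.1 l (hl.trans h)) x, hm.2, hn.1 m h, fun h' => ?_⟩))
      have : n = m + 1 := by
        by_contra hne
        exact h' (hn.1 (m + 1) (by omega))
      rw [this]
      exact address_above hF _ _ _
  · simp only [rowAddress_of_eq_zero hy, colAddress_of_isLevel hm]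
    exact Or.inr (Or.inr (Or.inl ⟨rfl, address_vStep hV (fun l _ => hy l) x, hm.2, hy m,
      fun h' => absurd (hy (m + 1)) h'⟩))
  · simp only [rowAddress_of_isLevel hn, colAddress_of_eq_zero hx]
    exact Or.inr (Or.inl ⟨rfl, address_hStep hH (fun l _ => hx l) y, hx n, hn.2,
      fun h' => absurd (hx (n + 1)) h'⟩)
  · simp only [rowAddress_of_eq_zero hy, colAddress_of_eq_zero hx]
    exact Or.inr (Or.inr (Or.inr ⟨rfl, rfl⟩))

lemma isLevel_zero {x : ℤ} (h : digit k p 0 x ≠ 0) : IsLevel k p x 0 :=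
  ⟨fun _ hm => absurd hm (Nat.not_lt_zero _), h⟩

lemma hierarchyCell_isValid (hF : ∀ n, IsComposition S (F (n + 1)) (F n) (p n) (q n))
    (hrel : ∀ n x y, relH (F (n + 1) x y) (F (n + 1) (x + 1) y) ∧
      relV (F (n + 1) x y) (F (n + 1) x (y + 1))) :
    IsValid S relH relV (hierarchyCell F p q k) := by
  have low : ∀ (p : ℕ → ℤ) (x : ℤ), digit k p 0 x = 0 →
      blockIndex k p 1 x = blockIndex k p 1 (x - 1) + 1 := fun p x h => by
    rw [blockIndex_sub_one_of_eq_zero (fun m hm => ?_), sub_add_cancel]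
    rwa [Nat.lt_one_iff.1 hm]
  intro x y
  constructor
  · exact digit_sub_one fun m hm => absurd hm (Nat.not_lt_zero _)
  · rfl
  · rfl
  · exact digit_sub_one fun m hm => absurd hm (Nat.not_lt_zero _)
  · intro h
    simp only [hierarchyCell, (isLevel_zero h).blockIndex_sub_one 1 one_pos]
  · intro h
    simp only [hierarchyCell, (isLevel_zero h).blockIndex_sub_one 1 one_pos]
  · intro h
    simp only [hierarchyCell, low p x h]
    exact (hrel 0 _ _).1
  · intro h
    simp only [hierarchyCell, low q y h]
    exact (hrel 0 _ _).2
  · intro h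
    simp only [hierarchyCell, rowAddress_of_isLevel (isLevel_zero h)]
    exact ⟨rfl, rfl, address_parent hF 0 x y⟩
  · intro h
    simp only [hierarchyCell, colAddress_of_isLevel (isLevel_zero h)]
    exact ⟨rfl, rfl, address_parent hF 0 x y⟩
  · exact hierarchyCell_crossing hF hrel x y

/-- The fields with a hierarchy are those defined by a local rule on cells. -/
theorem hasHierarchy_iff {f : ℤ → ℤ → A} :
    HasHierarchy S relH relV f ↔
      ∃ σ : ℤ → ℤ → Cell k A, IsValid S relH relV σ ∧ ∀ x y, (σ x y).form S = f x y := by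
  constructor
  · rintro ⟨F, p, q, rfl, hF, hrel⟩
    exact ⟨_, hierarchyCell_isValid hF hrel, fun x y => (hF 0 x y).symm⟩
  · rintro ⟨σ, hσ, h⟩
    have := hσ.hasHierarchy
    simpa only [h] using this

end Completeness
end SquareTiling

namespace SquareTiling

set_option linter.unusedSectionVars false

/-! ### Substitutive fields as hierarchies of legal `2 × 2` patterns. -/

section Supertiles

variable {k : ℕ} {A : Type*} (S : A → ZMod k → ZMod k → A)

/-- The substitution, applied to a field of labels. -/
def substitute (g : ℤ → ℤ → A) (x y : ℤ) : A := S (g (x / k) (y / k)) x y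

/-- The pattern of the supertile of order `n` and label `t` (at the points `(x, y)` with
`x / k ^ n = 0` and `y / k ^ n = 0`). -/
def superField (n : ℕ) (t : A) : ℤ → ℤ → A := (substitute S)^[n] fun _ _ => t

/-- Every finite pattern of `f` occurs in a supertile. -/
def IsSubstitutive (f : ℤ → ℤ → A) : Prop :=
  ∀ N : ℕ, ∃ (n : ℕ) (t : A) (a b : ℤ), ∀ x y : ℤ, |x| ≤ N → |y| ≤ N →
    (x + a) / (k : ℤ) ^ n = 0 ∧ (y + b) / (k : ℤ) ^ n = 0 ∧
      f x y = superField S n t (x + a) (y + b)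

/-- `0` or `1`, as a shift of a coordinate. -/
def shiftBy {R : Type*} [Zero R] [One R] (d : Bool) : R := if d then 1 else 0

/-- The `2 × 2` pattern `P` occurs in a supertile. -/
def IsLegal (P : Bool → Bool → A) : Prop :=
  ∃ (n : ℕ) (t : A) (a b : ℤ), ∀ d d' : Bool,
    (shiftBy d + a) / (k : ℤ) ^ n = 0 ∧ (shiftBy d' + b) / (k : ℤ) ^ n = 0 ∧
      P d d' = superField S n t (shiftBy d + a) (shiftBy d' + b)

/-- Whether the position `u + d` belongs to the next block. -/
def carry (d : Bool) (u : ZMod k) : Bool := d && decide (u + 1 = 0)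

/-- The substitution on `2 × 2` patterns. -/
def patternSubst (P : Bool → Bool → A) (u v : ZMod k) : Bool → Bool → A :=
  fun d d' => S (P (carry d u) (carry d' v)) (u + shiftBy d) (v + shiftBy d')

/-- Horizontal adjacency of legal `2 × 2` patterns. -/
def patternH (P Q : Bool → Bool → A) : Prop := IsLegal S P ∧ ∀ d, P true d = Q false d

/-- Vertical adjacency of `2 × 2` patterns. -/
def patternV (P Q : Bool → Bool → A) : Prop := ∀ d, P d true = Q d false

variable {S}

/-- A label in an `n`-fold substitution depends only on the label of the surrounding block of order
`n` and on the position in that block, so blocks can be moved by multiples of `k ^ n`. -/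
lemma iterate_substitute_congr (n : ℕ) {g h : ℤ → ℤ → A} {a b x y : ℤ} (hk : k ≠ 0)
    (H : g (x / (k : ℤ) ^ n) (y / (k : ℤ) ^ n) =
      h (x / (k : ℤ) ^ n + a) (y / (k : ℤ) ^ n + b)) :
    (substitute S)^[n] g x y =
      (substitute S)^[n] h (x + (k : ℤ) ^ n * a) (y + (k : ℤ) ^ n * b) := by
  have hk' : (k : ℤ) ≠ 0 := by exact_mod_cast hk
  induction n generalizing x y with
  | zero => simpa using H
  | succ n ih =>
    have e1 : ∀ x a : ℤ, (x + (k : ℤ) ^ (n + 1) * a) / k = x / k + (k : ℤ) ^ n * a := by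
      intro x a
      rw [pow_succ', mul_assoc, Int.add_mul_ediv_left _ _ hk']
    have e2 : ∀ x : ℤ, x / (k : ℤ) / (k : ℤ) ^ n = x / (k : ℤ) ^ (n + 1) := by
      intro x
      rw [Int.ediv_ediv_of_nonneg (Int.natCast_nonneg k), pow_succ']
    have e3 : ∀ x a : ℤ, ((x + (k : ℤ) ^ (n + 1) * a : ℤ) : ZMod k) = x := by
      intro x a
      push_cast
      rw [ZMod.natCast_self, zero_pow (Nat.succ_ne_zero n), zero_mul, add_zero]
    rw [Function.iterate_succ_apply', Function.iterate_succ_apply', substitute, substitute, e1, e1,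
      e3, e3, ← ih]
    rwa [e2, e2]

lemma exists_iterate_substitute (hk : k ≠ 0) {F : ℕ → ℤ → ℤ → A} {p q : ℕ → ℤ}
    (hF : ∀ n, IsComposition S (F (n + 1)) (F n) (p n) (q n)) (n : ℕ) :
    ∃ P Q : ℤ, ∀ x y, F 0 x y = (substitute S)^[n] (F n) (x + P) (y + Q) := by
  induction n with
  | zero => exact ⟨0, 0, fun x y => by simp⟩
  | succ n ih =>
    obtain ⟨P, Q, h⟩ := ih
    refine ⟨P + (k : ℤ) ^ n * p n, Q + (k : ℤ) ^ n * q n, fun x y => ?_⟩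
    rw [h, Function.iterate_succ_apply, ← add_assoc, ← add_assoc]
    exact iterate_substitute_congr n hk (hF n _ _)

lemma ediv_add_shiftBy [Fact (1 < k)] (x : ℤ) (d : Bool) :
    (x + shiftBy d) / (k : ℤ) = x / k + shiftBy (carry d (x : ZMod k)) := by
  cases d
  · simp [shiftBy, carry]
  · by_cases h : (x : ZMod k) + 1 = 0
    · have := ediv_sub_one_of_eq_zero (k := k) (x := x + 1) (by exact_mod_cast h)
      rw [add_sub_cancel_right] at this
      simp [shiftBy, carry, h, this]
    · have := ediv_sub_one_of_ne_zero (k := k) (x := x + 1) (by exact_mod_cast h)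
      rw [add_sub_cancel_right] at this
      simp [shiftBy, carry, h, this]

lemma Ultrafilter.exists_eventually_eq {α β : Type*} [Finite β] (U : Ultrafilter α) (φ : α → β) :
    ∃ c, ∀ᶠ a in U, φ a = c :=
  Ultrafilter.eventually_exists_iff.1 (Filter.Eventually.of_forall fun a => ⟨φ a, rfl⟩)

/-- A composition of a substitutive field, of which every finite part is a part of a composition
within a supertile. -/
lemma IsSubstitutive.exists_local [Fact (1 < k)] {f : ℤ → ℤ → A} (hf : IsSubstitutive S f) (N : ℕ) :
    ∃ (m : ℕ) (t : A) (p q : Set.Ico (0 : ℤ) k) (a b : ℤ), ∀ x y : ℤ, |x| ≤ N → |y| ≤ N →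
      ((x + p) / k + a) / (k : ℤ) ^ m = 0 ∧ ((y + q) / k + b) / (k : ℤ) ^ m = 0 ∧
      f x y = S (superField S m t ((x + p) / k + a) ((y + q) / k + b))
        ((x + p : ℤ) : ZMod k) ((y + q : ℤ) : ZMod k) := by
  have hk : (0 : ℤ) < k := by exact_mod_cast lt_trans one_pos (Fact.out : 1 < k)
  -- The larger window contains two neighbouring cells even for `N = 0`, which excludes supertiles
  -- of order `0`.
  obtain ⟨n, t, a, b, h⟩ := hf (N + 1)
  obtain _ | m := n
  · have h0 := (h 0 0 (by simp; positivity) (by simp; positivity)).1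
    have h1 := (h 1 0 (by simp) (by simp; positivity)).1
    simp at h0 h1
    omega
  refine ⟨m, t, ⟨a % k, Int.emod_nonneg _ hk.ne', Int.emod_lt_of_pos _ hk⟩,
    ⟨b % k, Int.emod_nonneg _ hk.ne', Int.emod_lt_of_pos _ hk⟩, a / k, b / k,
    fun x y hx hy => ?_⟩
  have e1 : ∀ x a : ℤ, (x + a % k) / k + a / k = (x + a) / k := fun x a => by
    conv_rhs => rw [← Int.emod_add_mul_ediv a k, ← add_assoc, Int.add_mul_ediv_left _ _ hk.ne']
  have e2 : ∀ x : ℤ, x / (k : ℤ) / (k : ℤ) ^ m = x / (k : ℤ) ^ (m + 1) := by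
    intro x
    rw [Int.ediv_ediv_of_nonneg (Int.natCast_nonneg k), pow_succ']
  have e3 : ∀ x a : ℤ, ((x + a % k : ℤ) : ZMod k) = ((x + a : ℤ) : ZMod k) := fun x a => by
    conv_rhs => rw [← Int.emod_add_mul_ediv a k]
    simp
  have := h x y (hx.trans (by push_cast; linarith)) (hy.trans (by push_cast; linarith))
  simp only [e1, e2, e3]
  refine ⟨this.1, this.2.1, this.2.2.trans ?_⟩
  rw [superField, Function.iterate_succ_apply']
  rfl

/-- A substitutive field has a substitutive composition. -/
lemma IsSubstitutive.exists_composition [Fact (1 < k)] [Finite A] {f : ℤ → ℤ → A}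
    (hf : IsSubstitutive S f) :
    ∃ (g : ℤ → ℤ → A) (p q : ℤ), IsSubstitutive S g ∧ IsComposition S g f p q := by
  have hk : (0 : ℤ) < k := by exact_mod_cast lt_trans one_pos (Fact.out : 1 < k)
  choose m t p q a b h using hf.exists_local
  -- Compactness: offsets and labels have finitely many values, so along a nonprincipal ultrafilter
  -- the local compositions converge at every place.
  let U : Ultrafilter ℕ := Filter.hyperfilter ℕ
  have hU : ∀ M : ℕ, ∀ᶠ N in U, M ≤ N := fun M =>
    Nat.hyperfilter_le_atTop (Filter.eventually_ge_atTop M)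
  obtain ⟨p₀, hp⟩ := Ultrafilter.exists_eventually_eq U p
  obtain ⟨q₀, hq⟩ := Ultrafilter.exists_eventually_eq U q
  have hg : ∀ X Y : ℤ, ∃ c, ∀ᶠ N in U, superField S (m N) (t N) (X + a N) (Y + b N) = c :=
    fun X Y => Ultrafilter.exists_eventually_eq U _
  choose g hg using hg
  refine ⟨g, p₀, q₀, fun M => ?_, fun x y => ?_⟩
  · have hall : ∀ᶠ N in U, ∀ X ∈ Finset.Icc (-M : ℤ) M, ∀ Y ∈ Finset.Icc (-M : ℤ) M,
        superField S (m N) (t N) (X + a N) (Y + b N) = g X Y := by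
      rw [Filter.eventually_all_finset]
      intro X _
      rw [Filter.eventually_all_finset]
      intro Y _
      exact hg X Y
    -- The blocks with indices up to `M` begin at cells at distance at most `k * M + k`, which the
    -- window of radius `N` must contain.
    obtain ⟨N, h1, h2, h3, h4⟩ := (hall.and (hp.and (hq.and (hU (k * M + k))))).exists
    refine ⟨m N, t N, a N, b N, fun X Y hX hY => ?_⟩
    have key : ∀ (X : ℤ) (r : Set.Ico (0 : ℤ) k), |X| ≤ M →
        |k * X - r| ≤ N ∧ (k * X - r + r) / (k : ℤ) = X := by
      intro X r hX
      refine ⟨?_, blockStart_ediv _ _⟩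
      have h5 : |(k : ℤ) * X| ≤ k * M := by
        rw [abs_mul, abs_of_pos hk]
        gcongr
      have h6 : |(r : ℤ)| ≤ k := by
        rw [abs_of_nonneg r.2.1]
        exact r.2.2.le
      have h7 : ((k * M + k : ℕ) : ℤ) ≤ N := by exact_mod_cast h4
      push_cast at h7
      exact (abs_sub _ _).trans (by linarith)
    have := h N _ _ (key X p₀ hX).1 (key Y q₀ hY).1
    rw [h2, h3, (key X p₀ hX).2, (key Y q₀ hY).2] at this
    exact ⟨this.1, this.2.1, (h1 X (Finset.mem_Icc.2 (abs_le.1 hX)) Y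
      (Finset.mem_Icc.2 (abs_le.1 hY))).symm⟩
  · obtain ⟨N, h1, h2, h3, h4⟩ := ((hg ((x + p₀) / k) ((y + q₀) / k)).and
      (hp.and (hq.and (hU (x.natAbs + y.natAbs))))).exists
    have := (h N x y (by rw [Int.abs_eq_natAbs]; omega) (by rw [Int.abs_eq_natAbs]; omega)).2.2
    rw [this, h2, h3, h1]

/-- A window around `0` reaching one step beyond `(x, y)` contains the whole pattern. -/
lemma IsSubstitutive.isLegal {f : ℤ → ℤ → A} (hf : IsSubstitutive S f) (x y : ℤ) :
    IsLegal S fun d d' => f (x + shiftBy d) (y + shiftBy d') := by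
  obtain ⟨n, t, a, b, h⟩ := hf (x.natAbs + y.natAbs + 1)
  refine ⟨n, t, x + a, y + b, fun d d' => ?_⟩
  have h01 : ∀ d, (shiftBy d : ℤ) = 0 ∨ (shiftBy d : ℤ) = 1 := by decide
  have := h (x + shiftBy d) (y + shiftBy d')
    (by have := h01 d; rw [Int.abs_eq_natAbs]; omega)
    (by have := h01 d'; rw [Int.abs_eq_natAbs]; omega)
  simpa only [add_left_comm (shiftBy _ : ℤ), ← add_assoc] using this

/-- The substitutive fields are those which have a hierarchy such that all `2 × 2` patterns, on all
levels, occur in supertiles. -/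
theorem isSubstitutive_iff [Fact (1 < k)] [Finite A] {f : ℤ → ℤ → A} :
    IsSubstitutive S f ↔ ∃ G : ℤ → ℤ → Bool → Bool → A,
      HasHierarchy (patternSubst S) (patternH S) patternV G ∧
        ∀ x y, G x y false false = f x y := by
  have hk : (0 : ℤ) < k := by exact_mod_cast lt_trans one_pos (Fact.out : 1 < k)
  have hk' : k ≠ 0 := by omega
  constructor
  · intro hf
    have step : ∀ f : {f : ℤ → ℤ → A // IsSubstitutive S f},
        ∃ (g : {f : ℤ → ℤ → A // IsSubstitutive S f}) (p q : ℤ),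
          IsComposition S g.1 f.1 p q := fun f => by
      obtain ⟨g, p, q, hg, h⟩ := f.2.exists_composition
      exact ⟨⟨g, hg⟩, p, q, h⟩
    choose next p q hc using step
    let seq : ℕ → {f : ℤ → ℤ → A // IsSubstitutive S f} := fun n => next^[n] ⟨f, hf⟩
    have hseq : ∀ n, seq (n + 1) = next (seq n) := fun n => Function.iterate_succ_apply' _ _ _
    let G : ℕ → ℤ → ℤ → Bool → Bool → A :=
      fun n x y d d' => (seq n).1 (x + shiftBy d) (y + shiftBy d')
    refine ⟨G 0, ⟨G, fun n => p (seq n), fun n => q (seq n), rfl, fun n x y => ?_,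
      fun n x y => ⟨⟨(seq (n + 1)).2.isLegal x y, fun d => ?_⟩, fun d => ?_⟩⟩, fun x y => ?_⟩
    · funext d d'
      simp only [G, patternSubst, hseq]
      rw [hc (seq n), add_right_comm, add_right_comm y, ediv_add_shiftBy, ediv_add_shiftBy]
      congr 1 <;> cases d <;> cases d' <;> simp [shiftBy]
    · simp [G, shiftBy]
    · simp [G, shiftBy]
    · simp [G, shiftBy, seq]
  · rintro ⟨G₀, ⟨G, p, q, rfl, hG, hrel⟩, hf⟩ N
    have hF : ∀ n, IsComposition S (fun x y => G (n + 1) x y false false)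
        (fun x y => G n x y false false) (p n) (q n) := fun n x y => by
      dsimp only
      rw [hG n x y]
      simp [patternSubst, carry, shiftBy]
    -- Blocks of order `n + 1` have side `k ^ (n + 1) > 2 * N`, so the window meets at most two of
    -- them in each direction. The order is positive, as the adjacency relations are only imposed
    -- there.
    set n := 2 * N with hn
    obtain ⟨P, Q, hPQ⟩ := exists_iterate_substitute hk'
      (F := fun n x y => G n x y false false) hF (n + 1)
    have hlt : (2 * N : ℤ) < (k : ℤ) ^ (n + 1) := by
      have := Nat.lt_pow_self (n := n + 1) (Fact.out : 1 < k)
      exact_mod_cast (by omega : 2 * N < k ^ (n + 1))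
    have hpos : (0 : ℤ) < (k : ℤ) ^ (n + 1) := by positivity
    have split : ∀ (x P : ℤ), |x| ≤ N → ∃ d : Bool, (x + P) / (k : ℤ) ^ (n + 1) =
        (-N + P) / (k : ℤ) ^ (n + 1) + shiftBy d := by
      intro x P hx
      rw [abs_le] at hx
      have h1 := Int.mul_ediv_add_emod (-N + P) ((k : ℤ) ^ (n + 1))
      have h2 := Int.emod_nonneg (-N + P) hpos.ne'
      have h3 := Int.emod_lt_of_pos (-N + P) hpos
      set z := (-N + P) / (k : ℤ) ^ (n + 1)
      by_cases h : x + P < (k : ℤ) ^ (n + 1) * (z + 1)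
      · refine ⟨false, ?_⟩
        rw [Int.ediv_eq_iff_of_pos hpos]
        simp only [shiftBy]
        constructor <;> simp <;> linarith [mul_comm z ((k : ℤ) ^ (n + 1))]
      · refine ⟨true, ?_⟩
        rw [Int.ediv_eq_iff_of_pos hpos]
        simp only [shiftBy]
        constructor <;> simp <;> linarith [mul_comm z ((k : ℤ) ^ (n + 1))]
    set X := (-N + P) / (k : ℤ) ^ (n + 1)
    set Y := (-N + Q) / (k : ℤ) ^ (n + 1)
    obtain ⟨m, t, a, b, hL⟩ := (hrel n X Y).1.1
    -- Adjacent patterns overlap, so the entries of one pattern are the labels of four actual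
    -- neighbouring blocks.
    have ov : ∀ d d', G (n + 1) X Y d d' =
        G (n + 1) (X + shiftBy d) (Y + shiftBy d') false false := by
      intro d d'
      have h1 := fun x y => (hrel n x y).1.2
      have h2 := fun x y => (hrel n x y).2
      cases d <;> cases d' <;> simp [shiftBy]
      · exact h2 X Y false
      · exact h1 X Y false
      · rw [h1 X Y true]
        exact h2 (X + 1) Y false
    -- The pattern of large blocks occurs in a supertile of order `m`; after `n + 1` further
    -- substitutions that supertile contains the window.
    refine ⟨n + 1 + m, t, P + (k : ℤ) ^ (n + 1) * (a - X), Q + (k : ℤ) ^ (n + 1) * (b - Y),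
      fun x y hx hy => ?_⟩
    obtain ⟨d, hd : _ = X + shiftBy d⟩ := split x P hx
    obtain ⟨d', hd' : _ = Y + shiftBy d'⟩ := split y Q hy
    have e : ∀ x P a : ℤ, (x + (P + (k : ℤ) ^ (n + 1) * a)) / (k : ℤ) ^ (n + 1 + m) =
        ((x + P) / (k : ℤ) ^ (n + 1) + a) / (k : ℤ) ^ m := fun x P a => by
      rw [pow_add _ (n + 1) m, ← Int.ediv_ediv_of_nonneg hpos.le, ← add_assoc,
        Int.add_mul_ediv_left _ _ hpos.ne']
    obtain ⟨l1, l2, l3⟩ := hL d d'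
    rw [e, e, hd, hd']
    refine ⟨by rw [← l1]; congr 1; ring, by rw [← l2]; congr 1; ring, ?_⟩
    rw [← hf, hPQ, superField, Function.iterate_add_apply _ (n + 1) m, ← add_assoc, ← add_assoc]
    refine iterate_substitute_congr _ hk' ?_
    rw [hd, hd', ← ov, l3, superField, show X + shiftBy d + (a - X) = shiftBy d + a by ring,
      show Y + shiftBy d' + (b - Y) = shiftBy d' + b by ring]

end Supertiles
end SquareTiling

namespace SquareTiling

open Complex

/-! ### Coordinates, interior and sides of a square. -/

namespace Square

variable (Q : Square)

lemma edge_ne_zero : Q.edge ≠ 0 := fun h => by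
  have := Q.edge_re_pos
  simp [h] at this

/-- The coordinates of a point with respect to a square. -/
noncomputable def coord (w : ℂ) : ℂ := (w - Q.corner) / Q.edge

lemma corner_add_coord (w : ℂ) : Q.corner + Q.edge * Q.coord w = w := by
  rw [coord, mul_div_cancel₀ _ Q.edge_ne_zero, add_sub_cancel]

lemma coord_corner_add (z : ℂ) : Q.coord (Q.corner + Q.edge * z) = z := by
  rw [coord, add_sub_cancel_left, mul_div_cancel_left₀ _ Q.edge_ne_zero]

/-- The affine parametrization of the plane which maps the unit square to `Q`. -/
noncomputable def chart : ℂ ≃ₜ ℂ where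
  toFun z := Q.corner + Q.edge * z
  invFun := Q.coord
  left_inv := Q.coord_corner_add
  right_inv := Q.corner_add_coord
  continuous_toFun := by fun_prop
  continuous_invFun := by unfold coord; fun_prop

lemma region_eq : Q.region = Q.chart '' (Set.Icc (0 : ℝ) 1 ×ℂ Set.Icc (0 : ℝ) 1) := rfl

lemma mem_region {w : ℂ} : w ∈ Q.region ↔
    (0 ≤ (Q.coord w).re ∧ (Q.coord w).re ≤ 1) ∧ 0 ≤ (Q.coord w).im ∧ (Q.coord w).im ≤ 1 := by
  rw [region_eq, ← Homeomorph.coe_toEquiv, Equiv.image_eq_preimage_symm]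
  rfl

lemma interior_region : interior Q.region = Q.chart '' (Set.Ioo (0 : ℝ) 1 ×ℂ Set.Ioo (0 : ℝ) 1) := by
  rw [region_eq, ← Homeomorph.image_interior, interior_reProdIm, interior_Icc]

lemma closure_interior_region : closure (interior Q.region) = Q.region := by
  rw [interior_region, ← Homeomorph.image_closure, closure_reProdIm, closure_Ioo zero_ne_one,
    region_eq]

lemma isClosed_region : IsClosed Q.region := by
  rw [← closure_interior_region]
  exact isClosed_closure

lemma mem_interior {w : ℂ} : w ∈ interior Q.region ↔
    (0 < (Q.coord w).re ∧ (Q.coord w).re < 1) ∧ 0 < (Q.coord w).im ∧ (Q.coord w).im < 1 := by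
  rw [interior_region, ← Homeomorph.coe_toEquiv, Equiv.image_eq_preimage_symm]
  rfl

lemma disjoint_region_interior {Q Q' : Square}
    (h : Disjoint (interior Q.region) (interior Q'.region)) :
    Disjoint Q.region (interior Q'.region) := by
  rw [← Q.closure_interior_region]
  exact h.closure_left isOpen_interior

/-- The centre of a square. -/
noncomputable def centre : ℂ := Q.corner + Q.edge * ((1 + I) / 2)

lemma ball_centre_subset : Metric.ball Q.centre (Q.sideLength / 2) ⊆ interior Q.region := by
  intro w hw
  have he : 0 < ‖Q.edge‖ := norm_pos_iff.2 Q.edge_ne_zero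
  have h1 : ‖Q.coord w - (1 + I) / 2‖ < 1 / 2 := by
    have : Q.coord w - (1 + I) / 2 = (w - Q.centre) / Q.edge := by
      rw [coord, centre]
      field_simp [Q.edge_ne_zero]
      ring
    rw [this, norm_div, div_lt_iff₀ he, ← dist_eq_norm]
    refine (Metric.mem_ball.1 hw).trans_le (le_of_eq ?_)
    rw [sideLength]
    ring
  have h2 := (abs_re_le_norm (Q.coord w - (1 + I) / 2)).trans_lt h1
  have h3 := (abs_im_le_norm (Q.coord w - (1 + I) / 2)).trans_lt h1
  rw [abs_lt] at h2 h3
  have e1 : ((1 + I) / 2 : ℂ).re = 1 / 2 := by simp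
  have e2 : ((1 + I) / 2 : ℂ).im = 1 / 2 := by simp
  rw [sub_re, e1] at h2
  rw [sub_im, e2] at h3
  rw [mem_interior]
  constructor <;> constructor <;> linarith

lemma centre_mem_interior : Q.centre ∈ interior Q.region :=
  Q.ball_centre_subset (Metric.mem_ball_self (half_pos (norm_pos_iff.2 Q.edge_ne_zero)))

lemma dist_centre_le {w : ℂ} (hw : w ∈ Q.region) : dist w Q.centre ≤ Q.sideLength := by
  rw [mem_region] at hw
  have : w - Q.centre = Q.edge * (Q.coord w - (1 + I) / 2) := by
    rw [mul_sub, centre, ← sub_sub]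
    congr 1
    nth_rewrite 1 [← Q.corner_add_coord w]
    ring
  rw [dist_eq_norm, this, norm_mul, sideLength]
  have h1 := norm_le_abs_re_add_abs_im (Q.coord w - (1 + I) / 2)
  have e1 : ((1 + I) / 2 : ℂ).re = 1 / 2 := by simp
  have e2 : ((1 + I) / 2 : ℂ).im = 1 / 2 := by simp
  rw [sub_re, e1, sub_im, e2] at h1
  have h2 : |(Q.coord w).re - 1 / 2| ≤ 1 / 2 := abs_le.2 ⟨by linarith, by linarith⟩
  have h3 : |(Q.coord w).im - 1 / 2| ≤ 1 / 2 := abs_le.2 ⟨by linarith, by linarith⟩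
  exact mul_le_of_le_one_right (norm_nonneg _) (by linarith)

lemma mem_side {w : ℂ} (j : Fin 4) : w ∈ Q.side j ↔
    (![0 ≤ (Q.coord w).re ∧ (Q.coord w).re ≤ 1 ∧ (Q.coord w).im = 0,
      0 ≤ (Q.coord w).im ∧ (Q.coord w).im ≤ 1 ∧ (Q.coord w).re = 1,
      0 ≤ (Q.coord w).re ∧ (Q.coord w).re ≤ 1 ∧ (Q.coord w).im = 1,
      0 ≤ (Q.coord w).im ∧ (Q.coord w).im ≤ 1 ∧ (Q.coord w).re = 0] : Fin 4 → Prop) j := by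
  have key : ∀ a b : ℂ, w ∈ segment ℝ (Q.corner + Q.edge * a) (Q.corner + Q.edge * b) ↔
      ∃ t : ℝ, (0 ≤ t ∧ t ≤ 1) ∧ a + t * (b - a) = Q.coord w := by
    intro a b
    rw [segment_eq_image']
    constructor
    · rintro ⟨t, ht, rfl⟩
      refine ⟨t, ht, ?_⟩
      rw [← Q.coord_corner_add (a + t * (b - a))]
      congr 1
      simp only [real_smul]
      ring
    · rintro ⟨t, ht, h⟩
      refine ⟨t, ht, ?_⟩
      rw [← Q.corner_add_coord w, ← h]
      simp only [real_smul]
      ring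
  rw [side, vertex, vertex, key]
  generalize Q.coord w = z
  simp only [Complex.ext_iff, add_re, add_im, re_ofReal_mul, im_ofReal_mul, sub_re, sub_im]
  fin_cases j <;> simp <;> constructor
  · rintro ⟨ht, h⟩
    exact ⟨ht.1, ht.2, h.symm⟩
  · rintro ⟨h1, h2, h3⟩
    exact ⟨⟨h1, h2⟩, h3.symm⟩
  · rintro ⟨ht, h⟩
    exact ⟨ht.1, ht.2, h.symm⟩
  · rintro ⟨h1, h2, h3⟩
    exact ⟨⟨h1, h2⟩, h3.symm⟩
  · rintro ⟨t, ht, h1, h2⟩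
    exact ⟨by linarith, by linarith, h2.symm⟩
  · rintro ⟨h1, h2, h3⟩
    exact ⟨1 - z.re, ⟨by linarith, by linarith⟩, by ring, h3.symm⟩
  · rintro ⟨t, ht, h1, h2⟩
    exact ⟨by linarith, by linarith, h1.symm⟩
  · rintro ⟨h1, h2, h3⟩
    exact ⟨1 - z.im, ⟨by linarith, by linarith⟩, h3.symm, by ring⟩

lemma exists_mem_side {w : ℂ} (h1 : w ∈ Q.region) (h2 : w ∉ interior Q.region) :
    ∃ j, w ∈ Q.side j := by
  rw [mem_region] at h1
  rw [mem_interior] at h2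
  by_contra! h
  have a0 := mt (Q.mem_side (w := w) 0).2 (h 0)
  have a1 := mt (Q.mem_side (w := w) 1).2 (h 1)
  have a2 := mt (Q.mem_side (w := w) 2).2 (h 2)
  have a3 := mt (Q.mem_side (w := w) 3).2 (h 3)
  simp at a0 a1 a2 a3
  refine h2 ⟨⟨lt_of_le_of_ne h1.1.1 fun e => ?_, lt_of_le_of_ne h1.1.2 fun e => ?_⟩,
    lt_of_le_of_ne h1.2.1 fun e => ?_, lt_of_le_of_ne h1.2.2 fun e => ?_⟩
  · exact a3 h1.2.1 h1.2.2 e.symm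
  · exact a1 h1.2.1 h1.2.2 e
  · exact a0 h1.1.1 h1.1.2 e.symm
  · exact a2 h1.1.1 h1.1.2 e

end Square

/-- With `c` and `d` at parameters `p, q ∈ [0, 1]` on the first segment, `0` and `1` must lie
between `p` and `q`, so these are `0` and `1` in some order. -/
lemma segment_eq_segment {a b c d : ℂ} (h : segment ℝ a b = segment ℝ c d) :
    (c = a ∧ d = b) ∨ (c = b ∧ d = a) := by
  by_cases hab : a = b
  · subst hab
    rw [segment_same] at h
    have h1 := h.symm ▸ left_mem_segment ℝ c d
    have h2 := h.symm ▸ right_mem_segment ℝ c d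
    exact Or.inl ⟨h1, h2⟩
  have ha := h ▸ left_mem_segment ℝ a b
  have hb := h ▸ right_mem_segment ℝ a b
  have hc := h.symm ▸ left_mem_segment ℝ c d
  have hd := h.symm ▸ right_mem_segment ℝ c d
  rw [segment_eq_image'] at ha hb hc hd
  obtain ⟨t, ⟨t0, t1⟩, ht⟩ := ha
  obtain ⟨u, ⟨u0, u1⟩, hu⟩ := hb
  obtain ⟨p, ⟨p0, p1⟩, rfl⟩ := hc
  obtain ⟨q, ⟨q0, q1⟩, rfl⟩ := hd
  have hne : b - a ≠ 0 := sub_ne_zero.2 (Ne.symm hab)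
  simp only [real_smul] at *
  have e1 : p + t * (q - p) = 0 := by
    have : ((p + t * (q - p) : ℝ) : ℂ) * (b - a) = 0 := by
      push_cast
      linear_combination ht
    have := (mul_eq_zero.1 this).resolve_right hne
    exact_mod_cast this
  have e2 : p + u * (q - p) = 1 := by
    have : ((p + u * (q - p) - 1 : ℝ) : ℂ) * (b - a) = 0 := by
      push_cast
      linear_combination hu
    have := (mul_eq_zero.1 this).resolve_right hne
    have : p + u * (q - p) - 1 = 0 := by exact_mod_cast this
    linarith
  rcases le_total p q with hpq | hpq
  · have hp : p = 0 := by nlinarith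
    have hq : q = 1 := by nlinarith
    left
    simp [hp, hq]
  · have hp : p = 1 := by nlinarith
    have hq : q = 0 := by nlinarith
    right
    simp [hp, hq]

/-- The direction from a square to its neighbour at the side `j`. -/
noncomputable def outward : Fin 4 → ℂ := ![-I, 1, I, -1]

/-- Edges are normalized to a half-open quadrant, so a common side forces equal edges. The squares
then coincide or lie on opposite sides of it, and disjoint interiors exclude the former. -/
lemma eq_neighbour_of_side_eq {Q Q' : Square} {j k : Fin 4} (h : Q.side j = Q'.side k)
    (hd : Disjoint (interior Q.region) (interior Q'.region)) :
    Q'.edge = Q.edge ∧ Q'.corner = Q.corner + Q.edge * outward j := by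
  have hne : ¬ (Q'.edge = Q.edge ∧ Q'.corner = Q.corner) := by
    rintro ⟨h1, h2⟩
    have : Q'.region = Q.region := by rw [Square.region, Square.region, h1, h2]
    rw [this] at hd
    exact Set.disjoint_left.1 hd Q.centre_mem_interior Q.centre_mem_interior
  have p1 := Q.edge_re_pos
  have p2 := Q.edge_im_nonneg
  have p3 := Q'.edge_re_pos
  have p4 := Q'.edge_im_nonneg
  rw [Complex.ext_iff, Complex.ext_iff] at hne ⊢
  rcases segment_eq_segment h with ⟨h1, h2⟩ | ⟨h1, h2⟩ <;>
    rw [Complex.ext_iff] at h1 h2 <;>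
    fin_cases j <;> fin_cases k <;>
    simp [Square.vertex, outward] at h1 h2 hne ⊢ <;>
    first
    | (exfalso; linarith)
    | (refine ⟨⟨?_, ?_⟩, ?_, ?_⟩ <;> linarith)
    | (exfalso; refine hne ?_ ?_ ?_ ?_ <;> linarith)

end SquareTiling

namespace SquareTiling

open Complex MeasureTheory

/-! ### Neighbours in side-to-side tilings by congruent squares. -/

section PlaneTilings

variable {κ : Type*} {α : κ → Square} {T : Set (Tile κ)}

lemma IsTiling.eq_of_mem (hT : IsTiling α T) {s t : Tile κ} (hs : s ∈ T) (ht : t ∈ T) {w : ℂ}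
    (h1 : w ∈ (place α s).region) (h2 : w ∈ interior (place α t).region) : s = t := by
  by_contra hne
  exact Set.disjoint_left.1 (Square.disjoint_region_interior (hT hs ht hne)) h1 h2

/-- Packing by area: the tiles contain disjoint discs of radius `l / 2`, all within one bounded
disc. -/
lemma IsTiling.finite_of_meeting_ball {l : ℝ} (hl : 0 < l) (hα : ∀ i, (α i).sideLength = l)
    (hT : IsTiling α T) {c : ℂ} {r : ℝ}
    (hr : ∀ t ∈ T, ((place α t).region ∩ Metric.closedBall c r).Nonempty) : T.Finite := by
  have hsub : ∀ t : T, Metric.ball (place α t.1).centre (l / 2) ⊆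
      interior (place α t.1).region := fun t => by
    rw [← hα t.1.1]
    exact (place α t.1).ball_centre_subset
  have hdisj : Pairwise (Function.onFun Disjoint
      fun t : T => Metric.ball (place α t.1).centre (l / 2)) := fun s t hst =>
    (hT s.2 t.2 fun h => hst (Subtype.ext h)).mono (hsub s) (hsub t)
  have hbdd : (⋃ t : T, Metric.ball (place α t.1).centre (l / 2)) ⊆
      Metric.closedBall c (r + 3 * l) := by
    refine Set.iUnion_subset fun t w hw => ?_
    obtain ⟨w', hw1, hw2⟩ := hr t.1 t.2
    have h1 : dist w' (place α t.1).centre ≤ l :=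
      ((place α t.1).dist_centre_le hw1).trans_eq (hα t.1.1)
    have h2 : dist w (place α t.1).centre < l / 2 := hw
    rw [Metric.mem_closedBall] at hw2 ⊢
    have h4 := dist_triangle w (place α t.1).centre c
    have h5 := dist_triangle_left (place α t.1).centre c w'
    linarith
  have hfin := Measure.finite_const_le_meas_of_disjoint_iUnion (volume : Measure ℂ)
    (ε := volume (Metric.ball (0 : ℂ) (l / 2)))
    (As := fun t : T => Metric.ball (place α t.1).centre (l / 2))
    (Metric.measure_ball_pos _ _ (half_pos hl)) (fun t => measurableSet_ball) hdisj
    ((measure_mono hbdd).trans_lt measure_closedBall_lt_top).ne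
  have : Finite T := Set.finite_univ_iff.1 <| hfin.subset fun t _ =>
    (Measure.addHaar_ball_center volume (place α t.1).centre (l / 2)).ge
  exact Set.toFinite T

/-- The points of the side `j`, in the coordinates of the square. -/
noncomputable def sidePoint (j : Fin 4) (τ : ℝ) : ℂ :=
  (![(τ : ℂ), 1 + τ * I, τ + I, τ * I] : Fin 4 → ℂ) j

lemma sidePoint_injective (j : Fin 4) : Function.Injective (sidePoint j) := by
  intro a b h
  rw [Complex.ext_iff] at h
  fin_cases j <;> simpa [sidePoint] using h

lemma norm_sidePoint_add_le (j : Fin 4) {τ ε : ℝ} (hτ : τ ∈ Set.Icc (0 : ℝ) 1)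
    (hε : ε ∈ Set.Icc (0 : ℝ) 1) : ‖sidePoint j τ + ε * outward j‖ ≤ 3 := by
  refine (norm_le_abs_re_add_abs_im _).trans ?_
  obtain ⟨t0, t1⟩ := hτ
  obtain ⟨e0, e1⟩ := hε
  have a1 : ∀ x : ℝ, -1 ≤ x → x ≤ 2 → |x| ≤ 2 := fun x h1 h2 => abs_le.2 ⟨by linarith, h2⟩
  have a2 : ∀ x : ℝ, 0 ≤ x → x ≤ 1 → |x| ≤ 1 := fun x h1 h2 => abs_le.2 ⟨by linarith, h2⟩
  fin_cases j <;> simp [sidePoint, outward]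
  · linarith [a2 τ t0 t1, a2 ε e0 e1]
  · linarith [a2 τ t0 t1, a1 (1 + ε) (by linarith) (by linarith)]
  · linarith [a2 τ t0 t1, a1 (1 + ε) (by linarith) (by linarith)]
  · linarith [a2 τ t0 t1, a2 ε e0 e1]

lemma Square.sidePoint_mem_side (Q : Square) (j : Fin 4) {τ : ℝ} (hτ : τ ∈ Set.Icc (0 : ℝ) 1) :
    Q.corner + Q.edge * sidePoint j τ ∈ Q.side j := by
  rw [mem_side, coord_corner_add]
  fin_cases j <;> simp [sidePoint, hτ.1, hτ.2]

lemma Square.sidePoint_mem_region (Q : Square) (j : Fin 4) {τ : ℝ} (hτ : τ ∈ Set.Icc (0 : ℝ) 1) :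
    Q.corner + Q.edge * sidePoint j τ ∈ Q.region := by
  rw [mem_region, coord_corner_add]
  fin_cases j <;> simp [sidePoint, hτ.1, hτ.2]

lemma Square.outside_notMem_region (Q : Square) (j : Fin 4) (τ : ℝ) {ε : ℝ} (hε : 0 < ε) :
    Q.corner + Q.edge * (sidePoint j τ + ε * outward j) ∉ Q.region := by
  rw [mem_region, coord_corner_add]
  rintro ⟨⟨h1, h2⟩, h3, h4⟩
  fin_cases j <;> simp [sidePoint, outward] at h1 h2 h3 h4 <;> linarith

/-- In a side-to-side tiling of the plane by congruent squares, every tile has neighbours. -/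
lemma IsPlaneTiling.exists_neighbour (hα : ∀ i j, (α i).sideLength = (α j).sideLength)
    (hT : IsPlaneTiling α T) (hs : SideToSide α T) {s : Tile κ} (hsT : s ∈ T) (j : Fin 4) :
    ∃ t ∈ T, (place α t).edge = (place α s).edge ∧
      (place α t).corner = (place α s).corner + (place α s).edge * outward j := by
  set Q := place α s with hQ
  set l := Q.sideLength with hl
  have hl0 : 0 < l := norm_pos_iff.2 Q.edge_ne_zero
  -- Points just outside the side lie within three side lengths of the corner
  -- (`norm_sidePoint_add_le`) and are covered by tiles other than `s`. There are finitely many such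
  -- tiles, so their union is closed and contains the side itself.
  set U := {t ∈ T | ((place α t).region ∩ Metric.closedBall Q.corner (l * 3)).Nonempty} \ {s}
    with hU
  have hUfin : U.Finite :=
    IsTiling.finite_of_meeting_ball hl0 (fun i => hα i s.1)
      (hT.1.mono (Set.sdiff_subset.trans (Set.sep_subset _ _))) fun t ht => ht.1.2
  have hclosed : IsClosed (⋃ t ∈ U, (place α t).region) :=
    hUfin.isClosed_biUnion fun t _ => (place α t).isClosed_region
  have hmem : ∀ τ ∈ Set.Icc (0 : ℝ) 1, ∃ tk : Tile κ × Fin 4, tk.1 ∈ U ∧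
      Q.corner + Q.edge * sidePoint j τ ∈ (place α tk.1).side tk.2 := by
    intro τ hτ
    have hcont : Continuous fun ε : ℝ => Q.corner + Q.edge * (sidePoint j τ + ε * outward j) := by
      fun_prop
    have hlim : Filter.Tendsto (fun ε : ℝ => Q.corner + Q.edge * (sidePoint j τ + ε * outward j))
        (nhdsWithin 0 (Set.Ioi 0)) (nhds (Q.corner + Q.edge * sidePoint j τ)) := by
      have := hcont.tendsto 0
      simp only [ofReal_zero, zero_mul, add_zero] at this
      exact this.mono_left nhdsWithin_le_nhds
    have hx : Q.corner + Q.edge * sidePoint j τ ∈ ⋃ t ∈ U, (place α t).region := by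
      refine hclosed.mem_of_tendsto hlim ?_
      filter_upwards [Ioo_mem_nhdsGT (zero_lt_one (α := ℝ))] with ε hε
      have hcov : Q.corner + Q.edge * (sidePoint j τ + ε * outward j) ∈ support α T := by
        rw [hT.2]
        trivial
      simp only [support, Set.mem_iUnion, exists_prop] at hcov ⊢
      obtain ⟨t, ht, hmem⟩ := hcov
      refine ⟨t, ⟨⟨ht, _, hmem, ?_⟩, ?_⟩, hmem⟩
      · rw [Metric.mem_closedBall, dist_eq_norm, add_sub_cancel_left, norm_mul]
        exact mul_le_mul_of_nonneg_left (norm_sidePoint_add_le j hτ ⟨hε.1.le, hε.2.le⟩)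
          (norm_nonneg _)
      · rintro rfl
        exact Q.outside_notMem_region j τ hε.1 hmem
    simp only [Set.mem_iUnion, exists_prop] at hx
    obtain ⟨t, ht, hxt⟩ := hx
    have hnot : Q.corner + Q.edge * sidePoint j τ ∉ interior (place α t).region := fun h =>
      ht.2 (hT.1.eq_of_mem hsT ht.1.1 (Q.sidePoint_mem_region j hτ) h).symm
    obtain ⟨k, hk⟩ := (place α t).exists_mem_side hxt hnot
    exact ⟨(t, k), ht, hk⟩
  have : Nonempty (Tile κ × Fin 4) := ⟨(s, j)⟩
  choose! φ hφ1 hφ2 using hmem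
  -- Pigeonhole: infinitely many points of the side lie on finitely many sides of other tiles, so
  -- one of these shares two points with it.
  obtain ⟨a, ha, b, hb, hab, he⟩ :=
    (Set.Icc_infinite (zero_lt_one (α := ℝ))).exists_ne_map_eq_of_mapsTo (f := φ)
    (t := U ×ˢ Set.univ) (fun τ hτ => ⟨hφ1 τ hτ, trivial⟩) (hUfin.prod Set.finite_univ)
  have ht := hφ1 a ha
  refine ⟨(φ a).1, ht.1.1, ?_⟩
  have hne : s ≠ (φ a).1 := fun h => ht.2 h.symm
  refine eq_neighbour_of_side_eq (k := (φ a).2) (hs s hsT _ ht.1.1 hne j _ ?_) (hT.1 hsT ht.1.1 hne)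
  refine ⟨_, ⟨Q.sidePoint_mem_side j ha, hφ2 a ha⟩, _, ⟨Q.sidePoint_mem_side j hb, ?_⟩, ?_⟩
  · rw [he]
    exact hφ2 b hb
  · intro h
    exact hab (sidePoint_injective j (mul_left_cancel₀ Q.edge_ne_zero (add_left_cancel h)))

end PlaneTilings

/-! ### Lattice tilings. -/

section Grids

variable {κ : Type*} (α : κ → Square)

/-- The tiles of forms `f x y` at the places `(x, y) ∈ Z` of the square lattice generated by `e`,
with origin `b`. -/
def gridTiles (b e : ℂ) (Z : Set (ℤ × ℤ)) (f : ℤ → ℤ → κ) : Set (Tile κ) :=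
  {t | ∃ x y : ℤ, (x, y) ∈ Z ∧ t.1 = f x y ∧ (place α t).corner = b + e * (x + y * I)}

variable {α} {b e : ℂ} {Z : Set (ℤ × ℤ)} {f : ℤ → ℤ → κ}

lemma coord_of_corner_eq {Q : Square} {x y : ℤ} (he : Q.edge = e)
    (h : Q.corner = b + e * (x + y * I)) (w : ℂ) :
    (Q.coord w).re = ((w - b) / e).re - x ∧ (Q.coord w).im = ((w - b) / e).im - y := by
  have : Q.coord w = (w - b) / e - (x + y * I) := by
    have h0 := Q.edge_ne_zero
    rw [Square.coord, h, he]
    rw [he] at h0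
    field_simp
    ring
  rw [this]
  simp

lemma gridTiles_isTiling (hf : ∀ x y, (x, y) ∈ Z → (α (f x y)).edge = e) :
    IsTiling α (gridTiles α b e Z f) := by
  rintro s ⟨x, y, hZ, hs1, hs2⟩ t ⟨x', y', hZ', ht1, ht2⟩ hst
  refine Set.disjoint_left.2 fun w hw hw' => hst ?_
  rw [Square.mem_interior] at hw hw'
  have es : (place α s).edge = e := by rw [← hf x y hZ, ← hs1]; rfl
  have et : (place α t).edge = e := by rw [← hf x' y' hZ', ← ht1]; rfl
  obtain ⟨h1, h2⟩ := coord_of_corner_eq es hs2 w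
  obtain ⟨h3, h4⟩ := coord_of_corner_eq et ht2 w
  rw [h1, h2] at hw
  rw [h3, h4] at hw'
  have hx : x = x' := by
    have a : (x : ℝ) < x' + 1 := by linarith
    have b : (x' : ℝ) < x + 1 := by linarith
    norm_cast at a b
    omega
  have hy : y = y' := by
    have a : (y : ℝ) < y' + 1 := by linarith
    have b : (y' : ℝ) < y + 1 := by linarith
    norm_cast at a b
    omega
  subst hx hy
  have h5 : s.1 = t.1 := hs1.trans ht1.symm
  refine Prod.ext h5 ?_
  have h6 := hs2.trans ht2.symm
  simp only [place, Square.shift, h5] at h6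
  exact add_left_cancel h6

lemma exists_mem_gridTiles (x y : ℤ) (h : (x, y) ∈ Z) :
    (f x y, b + e * (x + y * I) - (α (f x y)).corner) ∈ gridTiles α b e Z f :=
  ⟨x, y, h, rfl, by simp [place, Square.shift]⟩

lemma gridTiles_support (hf : ∀ x y, (α (f x y)).edge = e) :
    support α (gridTiles α b e Set.univ f) = Set.univ := by
  refine Set.eq_univ_of_forall fun w => ?_
  simp only [support, Set.mem_iUnion, exists_prop]
  refine ⟨_, exists_mem_gridTiles ⌊((w - b) / e).re⌋ ⌊((w - b) / e).im⌋ trivial, ?_⟩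
  rw [Square.mem_region]
  obtain ⟨h1, h2⟩ := coord_of_corner_eq (b := b) (e := e)
    (x := ⌊((w - b) / e).re⌋) (y := ⌊((w - b) / e).im⌋) (Q := place α (f ⌊((w - b) / e).re⌋ ⌊((w - b) / e).im⌋,
      b + e * ((⌊((w - b) / e).re⌋ : ℤ) + (⌊((w - b) / e).im⌋ : ℤ) * I) -
        (α (f ⌊((w - b) / e).re⌋ ⌊((w - b) / e).im⌋)).corner))
    (hf _ _) (by simp [place, Square.shift]) w
  rw [h1, h2]
  have h3 := Int.floor_le ((w - b) / e).re
  have h4 := Int.lt_floor_add_one ((w - b) / e).re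
  have h5 := Int.floor_le ((w - b) / e).im
  have h6 := Int.lt_floor_add_one ((w - b) / e).im
  constructor <;> constructor <;> linarith

/-- The horizontal and vertical unit segments of the lattice. -/
def gridSide (b e : ℂ) : Bool × ℤ × ℤ → Set ℂ
  | (true, x, y) => {w | ((w - b) / e).im = y ∧ x ≤ ((w - b) / e).re ∧ ((w - b) / e).re ≤ x + 1}
  | (false, x, y) => {w | ((w - b) / e).re = x ∧ y ≤ ((w - b) / e).im ∧ ((w - b) / e).im ≤ y + 1}

/-- The side `j` of the lattice square at `(x, y)`. -/
def sideIndex (j : Fin 4) (x y : ℤ) : Bool × ℤ × ℤ :=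
  (![(true, x, y), (false, x + 1, y), (true, x, y + 1), (false, x, y)] : Fin 4 → Bool × ℤ × ℤ) j

lemma side_eq_gridSide {Q : Square} {x y : ℤ} (he : Q.edge = e)
    (h : Q.corner = b + e * (x + y * I)) (j : Fin 4) :
    Q.side j = gridSide b e (sideIndex j x y) := by
  ext w
  obtain ⟨h1, h2⟩ := coord_of_corner_eq he h w
  rw [Square.mem_side, h1, h2]
  fin_cases j <;> simp [sideIndex, gridSide] <;> constructor <;> rintro ⟨a1, a2, a3⟩ <;>
    refine ⟨?_, ?_, ?_⟩ <;> linarith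

lemma gridSide_nontrivial (he : e ≠ 0) (i : Bool × ℤ × ℤ) : (gridSide b e i).Nontrivial := by
  obtain ⟨h, x, y⟩ := i
  have hne : ∀ z z' : ℂ, z ≠ z' → b + e * z ≠ b + e * z' := fun z z' h h' =>
    h (mul_left_cancel₀ he (add_left_cancel h'))
  have hc : ∀ z : ℂ, (b + e * z - b) / e = z := fun z => by field_simp; ring
  cases h
  · refine ⟨b + e * (x + y * I), ?_, b + e * (x + (y + 1) * I), ?_, hne _ _ ?_⟩
    · simp only [gridSide, Set.mem_ofPred_eq, hc]
      simp
    · simp only [gridSide, Set.mem_ofPred_eq, hc]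
      simp
    · simp [Complex.ext_iff]
  · refine ⟨b + e * (x + y * I), ?_, b + e * (x + 1 + y * I), ?_, hne _ _ ?_⟩
    · simp only [gridSide, Set.mem_ofPred_eq, hc]
      simp
    · simp only [gridSide, Set.mem_ofPred_eq, hc]
      simp
    · simp

/-- Distinct unit segments of the lattice share at most one point; hence lattice tilings are
side-to-side. -/
lemma eq_of_gridSide_inter_nontrivial (he : e ≠ 0) {i i' : Bool × ℤ × ℤ}
    (h : (gridSide b e i ∩ gridSide b e i').Nontrivial) : i = i' := by
  obtain ⟨w, ⟨h1, h1'⟩, w', ⟨h2, h2'⟩, hne⟩ := h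
  have hz : (w - b) / e ≠ (w' - b) / e := fun h =>
    hne (sub_left_injective ((div_left_inj' he).1 h))
  have key : ∀ (r r' : ℝ) (m n : ℤ), r ≠ r' → m ≤ r → r ≤ m + 1 → n ≤ r → r ≤ n + 1 →
      m ≤ r' → r' ≤ m + 1 → n ≤ r' → r' ≤ n + 1 → m = n := by
    intro r r' m n hr _ _ _ _ _ _ _ _
    rcases lt_or_gt_of_ne hr with hr | hr
    · have a : (m : ℝ) < n + 1 := by linarith
      have b : (n : ℝ) < m + 1 := by linarith
      norm_cast at a b
      omega
    · have a : (m : ℝ) < n + 1 := by linarith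
      have b : (n : ℝ) < m + 1 := by linarith
      norm_cast at a b
      omega
  obtain ⟨d, x, y⟩ := i
  obtain ⟨d', x', y'⟩ := i'
  cases d <;> cases d' <;> simp only [gridSide, Set.mem_ofPred_eq] at h1 h1' h2 h2'
  · have hx : x = x' := by exact_mod_cast h1.1.symm.trans h1'.1
    have hy := key _ _ y y' (fun h => hz (Complex.ext (h1.1.trans h2.1.symm) h)) h1.2.1 h1.2.2
      h1'.2.1 h1'.2.2 h2.2.1 h2.2.2 h2'.2.1 h2'.2.2
    rw [hx, hy]
  · exact absurd (Complex.ext (h1.1.trans h2.1.symm) (h1'.1.trans h2'.1.symm)) hz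
  · exact absurd (Complex.ext (h1'.1.trans h2'.1.symm) (h1.1.trans h2.1.symm)) hz
  · have hy : y = y' := by exact_mod_cast h1.1.symm.trans h1'.1
    have hx := key _ _ x x' (fun h => hz (Complex.ext h (h1.1.trans h2.1.symm))) h1.2.1 h1.2.2
      h1'.2.1 h1'.2.2 h2.2.1 h2.2.2 h2'.2.1 h2'.2.2
    rw [hx, hy]

lemma gridTiles_sideToSide (hf : ∀ x y, (x, y) ∈ Z → (α (f x y)).edge = e) :
    SideToSide α (gridTiles α b e Z f) := by
  rintro s ⟨x, y, hZ, hs1, hs2⟩ t ⟨x', y', hZ', ht1, ht2⟩ - j k h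
  have es : (place α s).edge = e := by rw [← hf x y hZ, ← hs1]; rfl
  have et : (place α t).edge = e := by rw [← hf x' y' hZ', ← ht1]; rfl
  rw [side_eq_gridSide es hs2, side_eq_gridSide et ht2] at h ⊢
  rw [eq_of_gridSide_inter_nontrivial (es ▸ (place α s).edge_ne_zero) h]

/-- A side-to-side tiling of the plane by congruent squares is a lattice tiling. -/
theorem IsPlaneTiling.exists_grid {T : Set (Tile κ)}
    (hα : ∀ i j, (α i).sideLength = (α j).sideLength) (hT : IsPlaneTiling α T)
    (hs : SideToSide α T) :
    ∃ (b e : ℂ) (f : ℤ → ℤ → κ), (∀ x y, (α (f x y)).edge = e) ∧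
      T = gridTiles α b e Set.univ f := by
  have h0 : (0 : ℂ) ∈ support α T := by rw [hT.2]; trivial
  simp only [support, Set.mem_iUnion, exists_prop] at h0
  obtain ⟨t₀, ht₀, -⟩ := h0
  set b := (place α t₀).corner with hb
  set e := (place α t₀).edge with he
  have hrow : ∀ x : ℤ, ∃ t ∈ T, (place α t).edge = e ∧ (place α t).corner = b + e * x := by
    intro x
    induction x with
    | zero => exact ⟨t₀, ht₀, rfl, by simp [hb]⟩
    | succ n ih =>
      obtain ⟨t, ht, h1, h2⟩ := ih
      obtain ⟨t', ht', h3, h4⟩ := hT.exists_neighbour hα hs ht 1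
      refine ⟨t', ht', h3.trans h1, ?_⟩
      rw [h4, h2, h1]
      simp [outward]
      ring
    | pred n ih =>
      obtain ⟨t, ht, h1, h2⟩ := ih
      obtain ⟨t', ht', h3, h4⟩ := hT.exists_neighbour hα hs ht 3
      refine ⟨t', ht', h3.trans h1, ?_⟩
      rw [h4, h2, h1]
      simp [outward]
      ring
  have hall : ∀ x y : ℤ, ∃ t ∈ T, (place α t).edge = e ∧
      (place α t).corner = b + e * (x + y * I) := by
    intro x y
    induction y with
    | zero => simpa using hrow x
    | succ n ih =>
      obtain ⟨t, ht, h1, h2⟩ := ih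
      obtain ⟨t', ht', h3, h4⟩ := hT.exists_neighbour hα hs ht 2
      refine ⟨t', ht', h3.trans h1, ?_⟩
      rw [h4, h2, h1]
      simp [outward]
      ring
    | pred n ih =>
      obtain ⟨t, ht, h1, h2⟩ := ih
      obtain ⟨t', ht', h3, h4⟩ := hT.exists_neighbour hα hs ht 0
      refine ⟨t', ht', h3.trans h1, ?_⟩
      rw [h4, h2, h1]
      simp [outward]
      ring
  choose t htT hte htc using hall
  have hf : ∀ x y, (α (t x y).1).edge = e := hte
  refine ⟨b, e, fun x y => (t x y).1, hf, Set.Subset.antisymm ?_ ?_⟩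
  -- The lattice tiles found in `T` already cover the plane, so the centre of any tile of `T` lies
  -- in one of them, which must be that tile.
  · intro s hsT
    have hc : (place α s).centre ∈ support α (gridTiles α b e Set.univ fun x y => (t x y).1) := by
      rw [gridTiles_support hf]
      trivial
    simp only [support, Set.mem_iUnion, exists_prop] at hc
    obtain ⟨s', ⟨x, y, -, h1, h2⟩, hs'⟩ := hc
    have h3 : s' = t x y := by
      refine Prod.ext h1 ?_
      have h4 := h2.trans (htc x y).symm
      simp only [place, Square.shift, h1] at h4
      exact add_left_cancel h4
    rw [h3] at hs'
    rw [← hT.1.eq_of_mem (htT x y) hsT hs' (place α s).centre_mem_interior]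
    exact ⟨x, y, trivial, rfl, htc x y⟩
  · rintro s ⟨x, y, -, h1, h2⟩
    have h3 : s = t x y := by
      refine Prod.ext h1 ?_
      have h4 := h2.trans (htc x y).symm
      simp only [place, Square.shift, h1] at h4
      exact add_left_cancel h4
    rw [h3]
    exact htT x y

/-! ### Encoding a local rule by colours of sides. -/

/-- Lattice squares which share a side are neighbours. -/
lemma sideIndex_eq {j k : Fin 4} {x y x' y' : ℤ} (h : sideIndex j x y = sideIndex k x' y')
    (hne : ¬ (x = x' ∧ y = y')) :
    (j = 0 ∧ k = 2 ∧ x' = x ∧ y' = y - 1) ∨ (j = 2 ∧ k = 0 ∧ x' = x ∧ y = y' - 1) ∨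
    (j = 1 ∧ k = 3 ∧ x = x' - 1 ∧ y' = y) ∨ (j = 3 ∧ k = 1 ∧ x' = x - 1 ∧ y' = y) := by
  fin_cases j <;> fin_cases k <;> simp [sideIndex] at h ⊢ <;> omega

/-- A family of lattice tilings given by a local rule is sofic. -/
theorem isSofic_of_localRule {ι : Type*} {α : ι → Square}
    (hα : ∀ i j, (α i).sideLength = (α j).sideLength) {C : Type} [Finite C]
    (R : C → C → C → Prop) (form : C → ι) {F : Set (Set (Tile ι))}
    (hF : ∀ T, T ∈ F ↔ ∃ (b e : ℂ) (σ : ℤ → ℤ → C),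
      (∀ x y, R (σ (x - 1) y) (σ x (y - 1)) (σ x y)) ∧ (∀ x y, (α (form (σ x y))).edge = e) ∧
        T = gridTiles α b e Set.univ fun x y => form (σ x y)) :
    IsSofic α F := by
  -- The colours are the symbols. The right and upper sides show the symbol of the tile, the lower
  -- and left sides those of the neighbours there; matching makes these guesses correct.
  refine ⟨C, inferInstance, {d | ∃ l u s, R l u s ∧ d = (form s, ![u, s, s, l])}, fun T => ?_⟩
  rw [hF]
  constructor
  · rintro ⟨b, e, σ, hσ, he, rfl⟩
    have he' : ∀ x y : ℤ, (decoratedSquare α C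
        (form (σ x y), ![σ x (y - 1), σ x y, σ x y, σ (x - 1) y])).edge = e := he
    have e0 : e ≠ 0 := he 0 0 ▸ (α _).edge_ne_zero
    refine ⟨gridTiles (decoratedSquare α C) b e Set.univ
      fun x y => (form (σ x y), ![σ x (y - 1), σ x y, σ x y, σ (x - 1) y]),
      ⟨?_, ⟨gridTiles_isTiling fun x y _ => he' x y, gridTiles_support he'⟩,
        gridTiles_sideToSide fun x y _ => he' x y, ?_⟩, ?_⟩
    · rintro t ⟨x, y, -, h, -⟩
      exact ⟨_, _, _, hσ x y, h⟩
    · rintro s ⟨x, y, -, hs1, hs2⟩ t ⟨x', y', -, ht1, ht2⟩ hst j k h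
      have es : (place (decoratedSquare α C) s).edge = e :=
        (congrArg (fun i => (decoratedSquare α C i).edge) hs1).trans (he' x y)
      have et : (place (decoratedSquare α C) t).edge = e :=
        (congrArg (fun i => (decoratedSquare α C i).edge) ht1).trans (he' x' y')
      rw [side_eq_gridSide es hs2, side_eq_gridSide et ht2] at h
      have hidx := eq_of_gridSide_inter_nontrivial e0 (i := sideIndex j x y)
        (i' := sideIndex k x' y') (by rw [h, Set.inter_self]; exact gridSide_nontrivial e0 _)
      have hne : ¬ (x = x' ∧ y = y') := by
        rintro ⟨rfl, rfl⟩
        have h5 : s.1 = t.1 := hs1.trans ht1.symm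
        refine hst (Prod.ext h5 ?_)
        have h6 := hs2.trans ht2.symm
        simp only [place, Square.shift, h5] at h6
        exact add_left_cancel h6
      rw [hs1, ht1]
      rcases sideIndex_eq hidx hne with ⟨rfl, rfl, rfl, rfl⟩ | ⟨rfl, rfl, rfl, rfl⟩ |
        ⟨rfl, rfl, rfl, rfl⟩ | ⟨rfl, rfl, rfl, rfl⟩ <;> rfl
    · ext t
      constructor
      · rintro ⟨t', ⟨x, y, -, h1, h2⟩, rfl⟩
        exact ⟨x, y, trivial, congrArg Prod.fst h1, h2⟩
      · rintro ⟨x, y, -, h1, h2⟩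
        refine ⟨((form (σ x y), ![σ x (y - 1), σ x y, σ x y, σ (x - 1) y]), t.2),
          ⟨x, y, trivial, rfl, ?_⟩, ?_⟩
        · rw [← h2]
          simp [place, decoratedSquare, h1]
        · simp [eraseColours, ← h1]
  · rintro ⟨T', hT', rfl⟩
    obtain ⟨b, e, f, he, hf⟩ := hT'.planeTiling.exists_grid (fun _ _ => hα _ _) hT'.sideToSide
    have e0 : e ≠ 0 := he 0 0 ▸ (α _).edge_ne_zero
    have hmem : ∀ x y : ℤ,
        (f x y, b + e * (x + y * I) - (decoratedSquare α C (f x y)).corner) ∈ T' :=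
      fun x y => by
        rw [hf]
        exact exists_mem_gridTiles x y trivial
    have hcorner : ∀ x y : ℤ, (place (decoratedSquare α C)
        (f x y, b + e * (x + y * I) - (decoratedSquare α C (f x y)).corner)).corner =
          b + e * (x + y * I) := fun x y => add_sub_cancel _ _
    have hside : ∀ (x y : ℤ) (j : Fin 4), (place (decoratedSquare α C)
        (f x y, b + e * (x + y * I) - (decoratedSquare α C (f x y)).corner)).side j =
          gridSide b e (sideIndex j x y) := fun x y j => by
      refine side_eq_gridSide ?_ (hcorner x y) j
      exact he x y
    have hmatch : ∀ (x y x' y' : ℤ) (j k : Fin 4), ¬ (x = x' ∧ y = y') →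
        sideIndex j x y = sideIndex k x' y' → (f x y).2 j = (f x' y').2 k := by
      intro x y x' y' j k hne h
      refine hT'.colours_match _ (hmem x y) _ (hmem x' y') ?_ j k ?_
      · intro h1
        have h2 := congrArg (fun t => (place (decoratedSquare α C) t).corner) h1
        simp [place, Square.shift, e0, Complex.ext_iff] at h2
        exact hne h2
      · exact (hside x y j).trans ((congrArg _ h).trans (hside x' y' k).symm)
    choose l u s hR hd using fun x y => hT'.allowed _ (hmem x y)
    have hd' : ∀ x y, f x y = (form (s x y), ![u x y, s x y, s x y, l x y]) := hd
    have hl : ∀ x y, l x y = s (x - 1) y := fun x y => by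
      have := hmatch (x - 1) y x y 1 3 (by omega) (by simp [sideIndex])
      rw [hd', hd'] at this
      exact this.symm
    have hu : ∀ x y, u x y = s x (y - 1) := fun x y => by
      have := hmatch x (y - 1) x y 2 0 (by omega) (by simp [sideIndex])
      rw [hd', hd'] at this
      exact this.symm
    refine ⟨b, e, s, fun x y => by rw [← hl, ← hu]; exact hR x y, fun x y => ?_, ?_⟩
    · rw [← he x y, hd']
    · ext t
      constructor
      · rintro ⟨t', ht', rfl⟩
        rw [hf] at ht'
        obtain ⟨x, y, -, h1, h2⟩ := ht'
        refine ⟨x, y, trivial, ?_, h2⟩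
        rw [eraseColours, h1, hd']
      · rintro ⟨x, y, -, h1, h2⟩
        refine ⟨_, hmem x y, Prod.ext ?_ ?_⟩
        · rw [eraseColours, h1, hd']
        · rw [← h2]
          simp [eraseColours, place, Square.shift, decoratedSquare, hd', h1]

end Grids
end SquareTiling

namespace SquareTiling

open Complex

/-! ### Tilings of a square by congruent squares. -/

section Rules

variable {κ : Type*} {α : κ → Square}

/-- The image of a square under a homothety centred at `0`. -/
noncomputable def Square.scale (Q : Square) {θ : ℝ} (hθ : 0 < θ) : Square where
  corner := θ * Q.corner
  edge := θ * Q.edge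
  edge_re_pos := by
    rw [re_ofReal_mul]
    exact mul_pos hθ Q.edge_re_pos
  edge_im_nonneg := by
    rw [im_ofReal_mul]
    exact mul_nonneg hθ.le Q.edge_im_nonneg

lemma Square.scale_region (Q : Square) {θ : ℝ} (hθ : 0 < θ) :
    (Q.scale hθ).region = (fun z : ℂ => (θ : ℂ) * z) '' Q.region := by
  rw [region, region, Set.image_image]
  refine Set.image_congr fun z _ => ?_
  simp only [scale]
  ring

lemma Square.scale_coord (Q : Square) {θ : ℝ} (hθ : 0 < θ) (w : ℂ) :
    (Q.scale hθ).coord w = ((θ⁻¹ : ℝ) : ℂ) * ((w - θ * Q.corner) / Q.edge) := by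
  have := Q.edge_ne_zero
  have : (θ : ℂ) ≠ 0 := by exact_mod_cast hθ.ne'
  simp only [coord, scale]
  push_cast
  field_simp

/-- If the unit square `(s, r) ↦ (u (s - a) - v (r - b), v (s - a) + u (r - b))`, which contains the
origin, lies in the first quadrant up to height `1`, then it is the standard one. -/
lemma eq_of_mem_quadrant {u v a b : ℝ} (hu : 0 < u) (huv : u ^ 2 + v ^ 2 = 1)
    (ha : 0 ≤ a ∧ a ≤ 1) (hb : 0 ≤ b ∧ b ≤ 1)
    (H : ∀ s r : ℝ, 0 ≤ s → s ≤ 1 → 0 ≤ r → r ≤ 1 → 0 ≤ v * (s - a) + u * (r - b) ∧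
      (0 ≤ u * (s - a) - v * (r - b) ∨ 1 ≤ v * (s - a) + u * (r - b))) :
    u = 1 ∧ v = 0 ∧ a = 0 ∧ b = 0 := by
  have hb0 : b = 0 := by
    have := (H a 0 ha.1 ha.2 le_rfl zero_le_one).1
    nlinarith
  subst hb0
  have ha0 : a = 0 := by
    -- The midpoint between the corner and the origin on the lower side: a positive `a` would put it
    -- left of the axis, and it cannot reach height `1`.
    have := (H (a / 2) 0 (by linarith) (by linarith) le_rfl zero_le_one).2
    rcases this with h | h
    · nlinarith
    · nlinarith [sq_nonneg (v + 1)]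
  subst ha0
  have hv : v = 0 := by
    have h1 := (H 1 0 zero_le_one le_rfl le_rfl zero_le_one).1
    have h2 := (H 0 (1 / 2) le_rfl zero_le_one (by norm_num) (by norm_num)).2
    rcases h2 with h | h
    · linarith
    · nlinarith
  subst hv
  exact ⟨by nlinarith, rfl, rfl, rfl⟩

variable {R : Set (Tile κ)} {Q : Square} {θ : ℝ}

/-- A finite tiling of a square by smaller congruent squares contains all lattice squares. -/
lemma exists_lattice_tile (hα : ∀ i, (α i).sideLength = Q.sideLength) (hθ : 0 < θ)
    (hR : R.Finite) (hT : IsTiling α R)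
    (hsupp : support α R = (fun z : ℂ => (θ : ℂ) * z) '' Q.region) (y : ℕ) :
    ∀ x : ℕ, (x : ℝ) < θ → (y : ℝ) < θ → ∃ t ∈ R, (place α t).edge = Q.edge ∧
      (place α t).corner = θ * Q.corner + Q.edge * ((x : ℤ) + (y : ℤ) * I) := by
  induction y using Nat.strong_induction_on with
  | _ y ihy =>
  intro x
  induction x using Nat.strong_induction_on with
  | _ x ihx =>
  intro hx hy
  set b : ℂ := θ * Q.corner with hb
  set e := Q.edge with he
  have e0 : e ≠ 0 := Q.edge_ne_zero
  have hθ' : θ⁻¹ * θ = 1 := inv_mul_cancel₀ hθ.ne'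
  rw [← Q.scale_region hθ] at hsupp
  have hsub : ∀ t ∈ R, (place α t).region ⊆ (Q.scale hθ).region := fun t ht => by
    rw [← hsupp]
    exact Set.subset_biUnion_of_mem (u := fun t => (place α t).region) ht
  have hint : ∀ t ∈ R, ∀ w ∈ interior (place α t).region,
      (0 < ((w - b) / e).re ∧ ((w - b) / e).re < θ) ∧
        0 < ((w - b) / e).im ∧ ((w - b) / e).im < θ := by
    intro t ht w hw
    have := interior_mono (hsub t ht) hw
    rw [Square.mem_interior, Square.scale_coord, re_ofReal_mul, im_ofReal_mul] at this
    have hi : 0 < θ⁻¹ := inv_pos.2 hθ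
    obtain ⟨⟨h1, h2⟩, h3, h4⟩ := this
    refine ⟨⟨pos_of_mul_pos_right h1 hi.le, ?_⟩, pos_of_mul_pos_right h3 hi.le, ?_⟩
    · rwa [inv_mul_lt_iff₀ hθ, mul_one] at h2
    · rwa [inv_mul_lt_iff₀ hθ, mul_one] at h4
  -- the tiles which are not lattice tiles at other places
  set K := {t ∈ R | ¬ ∃ x' y' : ℕ, ¬ (x' = x ∧ y' = y) ∧ (place α t).edge = e ∧
    (place α t).corner = b + e * ((x' : ℤ) + (y' : ℤ) * I)} with hK
  have hclosed : IsClosed (⋃ t ∈ K, (place α t).region) :=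
    (hR.subset (Set.sep_subset _ _)).isClosed_biUnion fun t _ => (place α t).isClosed_region
  have hcont : Continuous fun ε : ℝ => b + e * ((x + ε : ℝ) + (y + ε : ℝ) * I) := by fun_prop
  -- Approach the place `(x, y)` along the diagonal from its interior: the points there lie in no
  -- lattice tile at another place, so a tile of `K` contains the limit.
  have hP : b + e * (x + y * I) ∈ ⋃ t ∈ K, (place α t).region := by
    have hlim : Filter.Tendsto (fun ε : ℝ => b + e * ((x + ε : ℝ) + (y + ε : ℝ) * I))
        (nhdsWithin 0 (Set.Ioi 0)) (nhds (b + e * (x + y * I))) := by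
      have := hcont.tendsto 0
      simp only [add_zero, ofReal_natCast] at this
      exact this.mono_left nhdsWithin_le_nhds
    refine hclosed.mem_of_tendsto hlim ?_
    have hm : 0 < min 1 (min (θ - x) (θ - y)) :=
      lt_min one_pos (lt_min (sub_pos.2 hx) (sub_pos.2 hy))
    filter_upwards [Ioo_mem_nhdsGT hm] with ε hε
    obtain ⟨h0, h1⟩ := hε
    rw [lt_min_iff, lt_min_iff] at h1
    have hz : (b + e * ((x + ε : ℝ) + (y + ε : ℝ) * I) - b) / e =
        (x + ε : ℝ) + (y + ε : ℝ) * I := by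
      rw [add_sub_cancel_left, mul_div_cancel_left₀ _ e0]
    have hcov : b + e * ((x + ε : ℝ) + (y + ε : ℝ) * I) ∈ support α R := by
      rw [hsupp, Square.mem_region, Square.scale_coord, ← hb, ← he, hz, re_ofReal_mul,
        im_ofReal_mul]
      have hi : 0 < θ⁻¹ := inv_pos.2 hθ
      simp only [add_re, add_im, ofReal_re, ofReal_im, mul_re, mul_im, I_re, I_im, mul_zero,
        mul_one, sub_zero, add_zero, zero_add, inv_mul_le_iff₀ hθ]
      refine ⟨⟨by positivity, by linarith⟩, by positivity, by linarith⟩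
    simp only [support, Set.mem_iUnion, exists_prop] at hcov ⊢
    obtain ⟨t, ht, hmem⟩ := hcov
    refine ⟨t, ⟨ht, ?_⟩, hmem⟩
    rintro ⟨x', y', hne, h2, h3⟩
    obtain ⟨c1, c2⟩ := coord_of_corner_eq h2 h3 (b + e * ((x + ε : ℝ) + (y + ε : ℝ) * I))
    rw [Square.mem_region, c1, c2, hz] at hmem
    simp only [add_re, add_im, ofReal_re, ofReal_im, mul_re, mul_im, I_re, I_im, mul_zero,
      mul_one, sub_zero, add_zero, zero_add, Int.cast_natCast] at hmem
    have a1 : (x' : ℝ) < x + 1 := by linarith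
    have a2 : (x : ℝ) < x' + 1 := by linarith
    have a3 : (y' : ℝ) < y + 1 := by linarith
    have a4 : (y : ℝ) < y' + 1 := by linarith
    norm_cast at a1 a2 a3 a4
    omega
  simp only [Set.mem_iUnion, exists_prop] at hP
  obtain ⟨t, ht, hPt⟩ := hP
  -- By induction all places below, or to the left at the same height, are occupied by lattice
  -- tiles, so `t` cannot intrude there.
  have hquad_int : ∀ w ∈ interior (place α t).region, (y : ℝ) ≤ ((w - b) / e).im ∧
      ((x : ℝ) ≤ ((w - b) / e).re ∨ (y : ℝ) + 1 ≤ ((w - b) / e).im) := by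
    intro w hw
    by_contra hcon
    obtain ⟨⟨h1, h2⟩, h3, h4⟩ := hint t ht.1 w hw
    have f1 := Nat.floor_le h1.le
    have f2 := Nat.lt_floor_add_one ((w - b) / e).re
    have f3 := Nat.floor_le h3.le
    have f4 := Nat.lt_floor_add_one ((w - b) / e).im
    set x' := ⌊((w - b) / e).re⌋₊
    set y' := ⌊((w - b) / e).im⌋₊
    have hlex : y' < y ∨ (y' = y ∧ x' < x) := by
      by_contra hlex
      push Not at hlex
      refine hcon ⟨(Nat.cast_le.2 hlex.1).trans f3, ?_⟩
      rcases hlex.1.eq_or_lt with h | h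
      · exact Or.inl ((Nat.cast_le.2 (hlex.2 h.symm)).trans f1)
      · exact Or.inr (le_trans (by exact_mod_cast h) f3)
    obtain ⟨s, hs, s1, s2⟩ : ∃ s ∈ R, (place α s).edge = e ∧
        (place α s).corner = b + e * ((x' : ℤ) + (y' : ℤ) * I) := by
      rcases hlex with h | ⟨h, h'⟩
      · exact ihy y' h x' (f1.trans_lt h2) (f3.trans_lt h4)
      · rw [h]
        exact ihx x' h' (f1.trans_lt h2) hy
    obtain ⟨c1, c2⟩ := coord_of_corner_eq s1 s2 w
    have hws : w ∈ (place α s).region := by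
      rw [Square.mem_region, c1, c2]
      simp only [Int.cast_natCast]
      exact ⟨⟨by linarith, by linarith⟩, by linarith, by linarith⟩
    have hst := hT.eq_of_mem hs ht.1 hws hw
    rw [hst] at s1 s2
    exact ht.2 ⟨x', y', by omega, s1, s2⟩
  have hquad : ∀ w ∈ (place α t).region, (y : ℝ) ≤ ((w - b) / e).im ∧
      ((x : ℝ) ≤ ((w - b) / e).re ∨ (y : ℝ) + 1 ≤ ((w - b) / e).im) := by
    have c1 : Continuous fun w : ℂ => ((w - b) / e).im := by fun_prop
    have c2 : Continuous fun w : ℂ => ((w - b) / e).re := by fun_prop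
    have hcl : IsClosed ({w : ℂ | (y : ℝ) ≤ ((w - b) / e).im} ∩
        ({w : ℂ | (x : ℝ) ≤ ((w - b) / e).re} ∪ {w : ℂ | (y : ℝ) + 1 ≤ ((w - b) / e).im})) :=
      (isClosed_le continuous_const c1).inter
        ((isClosed_le continuous_const c2).union (isClosed_le continuous_const c1))
    rw [← (place α t).closure_interior_region]
    exact closure_minimal hquad_int hcl
  set E := (place α t).edge with hE
  set ζ := (place α t).coord (b + e * (x + y * I)) with hζ
  have hζP : (place α t).corner + E * ζ = b + e * (x + y * I) := (place α t).corner_add_coord _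
  have hnorm : ‖E / e‖ = 1 := by
    rw [norm_div, div_eq_one_iff_eq (norm_ne_zero_iff.2 e0)]
    exact hα t.1
  have huv : (E / e).re ^ 2 + (E / e).im ^ 2 = 1 := by
    have := Complex.sq_norm (E / e)
    rw [hnorm, Complex.normSq_apply] at this
    linarith
  -- Both edges have arguments in `[0, π/2)`, so they differ by an angle less than `π/2`.
  have hu : 0 < (E / e).re := by
    rw [div_re, ← add_div]
    refine div_pos ?_ (normSq_pos.2 e0)
    have h1 := mul_pos (place α t).edge_re_pos Q.edge_re_pos
    have h2 := mul_nonneg (place α t).edge_im_nonneg Q.edge_im_nonneg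
    linarith
  have hreg := (place α t).mem_region.1 hPt
  obtain ⟨q1, q2, q3, q4⟩ := eq_of_mem_quadrant hu huv hreg.1 hreg.2 (by
    intro s r s0 s1 r0 r1
    have hw : (place α t).corner + E * (s + r * I) ∈ (place α t).region := by
      rw [Square.mem_region, Square.coord_corner_add]
      simp [s0, s1, r0, r1]
    have hz : ((place α t).corner + E * (s + r * I) - b) / e =
        (x + y * I) + E / e * ((s + r * I) - ζ) := by
      have : (place α t).corner = b + e * (x + y * I) - E * ζ := by rw [← hζP]; ring
      rw [this]
      field_simp
      ring
    have := hquad _ hw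
    rw [hz] at this
    simp only [add_re, add_im, ofReal_re, ofReal_im, mul_re, mul_im, I_re, I_im, mul_zero,
      mul_one, sub_zero, add_zero, zero_add, natCast_re, natCast_im, sub_re, sub_im] at this
    refine ⟨by linarith, ?_⟩
    rcases this.2 with h | h
    · left
      linarith
    · right
      linarith)
  have hEe : E / e = 1 := Complex.ext q1 q2
  have hζ0 : ζ = 0 := Complex.ext q3 q4
  refine ⟨t, ht.1, (div_eq_one_iff_eq e0).1 hEe, ?_⟩
  rw [hζ0, mul_zero, add_zero] at hζP
  rw [hζP]
  push_cast
  rfl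

/-- The last lattice tile of the bottom row, at `⌈θ⌉ - 1`, ends at `⌈θ⌉` and still fits into the
stretched square, whence `⌈θ⌉ ≤ θ`. -/
lemma exists_natCast_eq (hα : ∀ i, (α i).sideLength = Q.sideLength) (hθ : 0 < θ)
    (hR : R.Finite) (hT : IsTiling α R)
    (hsupp : support α R = (fun z : ℂ => (θ : ℂ) * z) '' Q.region) : ∃ k : ℕ, (k : ℝ) = θ := by
  obtain ⟨n, hn⟩ := Nat.exists_eq_succ_of_ne_zero (Nat.ceil_pos.2 hθ).ne'
  have h1 : (n : ℝ) < θ := Nat.lt_ceil.1 (by omega)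
  have h2 : θ ≤ n + 1 := by
    have := Nat.le_ceil θ
    rw [hn] at this
    exact_mod_cast this
  obtain ⟨t, ht, he, hc⟩ := exists_lattice_tile hα hθ hR hT hsupp 0 n h1 (by simpa using hθ)
  refine ⟨n + 1, le_antisymm ?_ (by exact_mod_cast h2)⟩
  have hw : (place α t).corner + (place α t).edge * 1 ∈ (place α t).region := by
    rw [Square.mem_region, Square.coord_corner_add]
    simp
  have hw' : (place α t).corner + (place α t).edge * 1 ∈ support α R :=
    Set.mem_biUnion (t := fun t => (place α t).region) ht hw
  have := Q.edge_ne_zero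
  rw [hsupp, ← Q.scale_region hθ, Square.mem_region, Square.scale_coord, hc, he] at hw'
  have hz : (θ * Q.corner + Q.edge * ((n : ℤ) + ((0 : ℕ) : ℤ) * I) + Q.edge * 1 - θ * Q.corner) /
      Q.edge = n + 1 := by
    field_simp
    push_cast
    ring
  rw [hz, re_ofReal_mul, inv_mul_le_iff₀ hθ] at hw'
  have := hw'.1.2
  simpa using this

end Rules
end SquareTiling

namespace SquareTiling

open Complex

/-! ### From substitutions of squares to substitutions of labels. -/

section Lattice

variable {κ : Type*} {α : κ → Square} {b e : ℂ} {f : ℤ → ℤ → κ}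

lemma Tile.ext_of_corner {s t : Tile κ} (h : s.1 = t.1)
    (hc : (place α s).corner = (place α t).corner) : s = t := by
  refine Prod.ext h ?_
  simp only [place, Square.shift, h] at hc
  exact add_left_cancel hc

lemma lattice_injective (he : e ≠ 0) {x y x' y' : ℤ}
    (h : b + e * (x + y * I) = b + e * (x' + y' * I)) : x = x' ∧ y = y' := by
  have := mul_left_cancel₀ he (add_left_cancel h)
  simpa [Complex.ext_iff] using this

/-- Translation of the index set of a lattice tiling. -/
lemma gridTiles_translate (p q : ℤ) (Z : Set (ℤ × ℤ)) :
    gridTiles α b e Z f = gridTiles α (b + e * (p + q * I)) e {z | (z.1 + p, z.2 + q) ∈ Z}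
      (fun x y => f (x + p) (y + q)) := by
  ext t
  constructor
  · rintro ⟨x, y, hZ, h1, h2⟩
    refine ⟨x - p, y - q, by simpa using hZ, by simpa using h1, ?_⟩
    rw [h2]
    push_cast
    ring
  · rintro ⟨x, y, hZ, h1, h2⟩
    refine ⟨x + p, y + q, hZ, h1, ?_⟩
    rw [h2]
    push_cast
    ring

/-- The places of the tiles of a lattice tiling within another one. -/
lemma gridTiles_subset {b' e' : ℂ} {f' : ℤ → ℤ → κ} {Z Z' : Set (ℤ × ℤ)}
    (hf : ∀ x y, (x, y) ∈ Z → (α (f x y)).edge = e)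
    (hf' : ∀ x y, (x, y) ∈ Z' → (α (f' x y)).edge = e') (h0 : (0, 0) ∈ Z)
    (h : gridTiles α b e Z f ⊆ gridTiles α b' e' Z' f') :
    e = e' ∧ ∃ p q : ℤ, b = b' + e * (p + q * I) ∧
      ∀ x y, (x, y) ∈ Z → (x + p, y + q) ∈ Z' ∧ f x y = f' (x + p) (y + q) := by
  obtain ⟨p, q, hpq, h1, h2⟩ := h (exists_mem_gridTiles (b := b) (e := e) (f := f) 0 0 h0)
  have hcorner : ∀ x y : ℤ, (place α (f x y, b + e * (x + y * I) - (α (f x y)).corner)).corner =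
      b + e * (x + y * I) := fun x y => add_sub_cancel _ _
  have he : e = e' := by
    rw [← hf 0 0 h0, ← hf' p q hpq]
    exact congrArg (fun i => (α i).edge) h1
  subst he
  have e0 : e ≠ 0 := hf 0 0 h0 ▸ (α _).edge_ne_zero
  have hb : b = b' + e * (p + q * I) := by
    rw [← h2, hcorner]
    simp
  refine ⟨rfl, p, q, hb, fun x y hxy => ?_⟩
  obtain ⟨x', y', hZ', h3, h4⟩ := h (exists_mem_gridTiles (b := b) (e := e) (f := f) x y hxy)
  rw [hcorner, hb] at h4
  obtain ⟨rfl, rfl⟩ := lattice_injective (x := x + p) (y := y + q) e0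
    ((show b' + e * (((x + p : ℤ) : ℂ) + ((y + q : ℤ) : ℂ) * I) =
      b' + e * (p + q * I) + e * (x + y * I) by push_cast; ring).trans h4)
  exact ⟨hZ', h3⟩

end Lattice

/-- The combinatorial description of a substitution: the rule for the form `i` consists of the
tiles of forms `S i u v` at the places `(u, v)` of the square lattice. -/
structure Substitution.IsLattice {ι : Type*} (τ : Substitution ι) (k : ℕ)
    (S : ι → ZMod k → ZMod k → ι) : Prop where
  factor : τ.factor = k
  edge : ∀ i u v, (τ.prototile (S i u v)).edge = (τ.prototile i).edge
  mem_rule : ∀ i t, t ∈ τ.rule i ↔ ∃ u v : ZMod k, t.1 = S i u v ∧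
    (place τ.prototile t).corner =
      τ.factor * (τ.prototile i).corner + (τ.prototile i).edge * (u.val + v.val * I)

/-- The lattice tiles in a rule fill the stretched square, so any tile of the rule has its centre in
one of them and equals it. -/
theorem Substitution.exists_isLattice {ι : Type*} [Nonempty ι] (τ : Substitution ι)
    (hα : ∀ i j, (τ.prototile i).sideLength = (τ.prototile j).sideLength) :
    ∃ k : ℕ, 1 < k ∧ ∃ S : ι → ZMod k → ZMod k → ι, τ.IsLattice k S := by
  have hθ : 0 < τ.factor := one_pos.trans τ.one_lt_factor
  obtain ⟨i₀⟩ := ‹Nonempty ι›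
  obtain ⟨k, hk⟩ := exists_natCast_eq (fun i => hα i i₀) hθ (τ.rule_finite i₀)
    (τ.rule_isTiling i₀) (τ.rule_support i₀)
  have hk1 : 1 < k := by
    have := τ.one_lt_factor
    rw [← hk] at this
    exact_mod_cast this
  have : NeZero k := ⟨by omega⟩
  have htile : ∀ (i : ι) (u v : ZMod k), ∃ t ∈ τ.rule i,
      (place τ.prototile t).edge = (τ.prototile i).edge ∧ (place τ.prototile t).corner =
        τ.factor * (τ.prototile i).corner +
          (τ.prototile i).edge * ((u.val : ℤ) + (v.val : ℤ) * I) := by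
    intro i u v
    refine exists_lattice_tile (fun j => hα j i) hθ (τ.rule_finite i) (τ.rule_isTiling i)
      (τ.rule_support i) v.val u.val ?_ ?_
    · rw [← hk]
      exact_mod_cast u.val_lt
    · rw [← hk]
      exact_mod_cast v.val_lt
  choose t ht he hc using htile
  refine ⟨k, hk1, fun i u v => (t i u v).1, hk.symm, he, fun i s => ⟨fun hs => ?_, ?_⟩⟩
  · set Q := τ.prototile i
    obtain ⟨w, hwin⟩ : ∃ w, w ∈ interior (place τ.prototile s).region :=
      ⟨_, (place τ.prototile s).centre_mem_interior⟩
    have hsub : (place τ.prototile s).region ⊆ (Q.scale hθ).region := by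
      rw [Q.scale_region hθ, ← τ.rule_support i]
      exact Set.subset_biUnion_of_mem (u := fun t => (place τ.prototile t).region) hs
    have hint := interior_mono hsub hwin
    rw [Square.mem_interior, Square.scale_coord, re_ofReal_mul, im_ofReal_mul] at hint
    have hi : 0 < τ.factor⁻¹ := inv_pos.2 hθ
    obtain ⟨⟨h1, h2⟩, h3, h4⟩ := hint
    rw [inv_mul_lt_iff₀ hθ, mul_one, ← hk] at h2 h4
    rw [← hk] at h1 h3
    replace h1 := (pos_of_mul_pos_right h1 (by positivity)).le
    replace h3 := (pos_of_mul_pos_right h3 (by positivity)).le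
    have f1 := Nat.floor_le h1
    have f2 := Nat.lt_floor_add_one ((w - ((k : ℝ) : ℂ) * Q.corner) / Q.edge).re
    have f3 := Nat.floor_le h3
    have f4 := Nat.lt_floor_add_one ((w - ((k : ℝ) : ℂ) * Q.corner) / Q.edge).im
    set x := ⌊((w - ((k : ℝ) : ℂ) * Q.corner) / Q.edge).re⌋₊
    set y := ⌊((w - ((k : ℝ) : ℂ) * Q.corner) / Q.edge).im⌋₊
    have hx : x < k := by exact_mod_cast f1.trans_lt h2
    have hy : y < k := by exact_mod_cast f3.trans_lt h4
    obtain ⟨c1, c2⟩ := coord_of_corner_eq (he i x y) (hc i x y) w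
    rw [ZMod.val_natCast_of_lt hx, ← hk] at c1
    rw [ZMod.val_natCast_of_lt hy, ← hk] at c2
    have hmem : w ∈ (place τ.prototile (t i x y)).region := by
      rw [Square.mem_region, c1, c2]
      simp only [Int.cast_natCast]
      exact ⟨⟨by linarith, by linarith⟩, by linarith, by linarith⟩
    have hst := (τ.rule_isTiling i).eq_of_mem (ht i x y) hs hmem hwin
    refine ⟨x, y, by rw [← hst], ?_⟩
    rw [← hst, hc]
    push_cast
    rfl
  · rintro ⟨u, v, h1, h2⟩
    have : s = t i u v := Tile.ext_of_corner (α := τ.prototile) h1 (by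
      rw [h2, hc]
      push_cast
      rfl)
    rw [this]
    exact ht i u v

section Reduction

variable {ι : Type*} {τ : Substitution ι} {k : ℕ} {S : ι → ZMod k → ZMod k → ι}

lemma Substitution.IsLattice.substitute_edge (hS : τ.IsLattice k S) {f : ℤ → ℤ → ι} {e : ℂ}
    {x y : ℤ} (h : (τ.prototile (f (x / k) (y / k))).edge = e) :
    (τ.prototile (substitute S f x y)).edge = e := (hS.edge _ _ _).trans h

variable [Fact (1 < k)]

/-- Decomposition of lattice tilings. -/
lemma Substitution.IsLattice.decompose_gridTiles (hS : τ.IsLattice k S) {b e : ℂ}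
    {Z : Set (ℤ × ℤ)} {f : ℤ → ℤ → ι}
    (hf : ∀ x y, (x, y) ∈ Z → (τ.prototile (f x y)).edge = e) :
    τ.decompose (gridTiles τ.prototile b e Z f) =
      gridTiles τ.prototile (τ.factor * b) e {z | (z.1 / (k : ℤ), z.2 / (k : ℤ)) ∈ Z}
        (substitute S f) := by
  have hk : (0 : ℤ) < k := by exact_mod_cast lt_trans one_pos (Fact.out : 1 < k)
  have : NeZero k := ⟨by omega⟩
  have hθ : (τ.factor : ℂ) = k := by rw [hS.factor, ofReal_natCast]
  have hval : ∀ x : ℤ, (k : ℂ) * ((x / k : ℤ) : ℂ) + (((x : ZMod k).val : ℕ) : ℂ) = x := fun x => by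
    have h1 := ZMod.val_intCast (n := k) x
    have h2 := Int.mul_ediv_add_emod x k
    rw [← h1] at h2
    exact_mod_cast h2
  ext t
  constructor
  · rintro ⟨p, ⟨X, Y, hZ, hp1, hp2⟩, q, hq, rfl⟩
    obtain ⟨u, v, h1, h2⟩ := (hS.mem_rule _ _).1 hq
    have hdiv : ∀ (X : ℤ) (u : ZMod k), (k * X + (u.val : ℤ)) / (k : ℤ) = X := fun X u => by
      rw [Int.ediv_eq_iff_of_pos hk]
      have := u.val_lt
      constructor <;> linarith [mul_comm X (k : ℤ), (by exact_mod_cast this : (u.val : ℤ) < k),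
        Int.natCast_nonneg u.val]
    have hcast : ∀ (X : ℤ) (u : ZMod k), ((k * X + (u.val : ℤ) : ℤ) : ZMod k) = u := fun X u => by
      simp
    refine ⟨k * X + u.val, k * Y + v.val, ?_, ?_, ?_⟩
    · show (_, _) ∈ Z
      rwa [hdiv, hdiv]
    · rw [substitute, hdiv, hdiv, hcast, hcast, ← hp1]
      exact h1
    · simp only [place, Square.shift] at h2 hp2 ⊢
      rw [hp1, hf X Y hZ, ← hp1] at h2
      rw [← add_assoc, h2]
      push_cast
      rw [hθ]
      linear_combination (k : ℂ) * hp2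
  · rintro ⟨x, y, hZ, h1, h2⟩
    change ((x / (k : ℤ), y / (k : ℤ)) : ℤ × ℤ) ∈ Z at hZ
    refine ⟨(f (x / k) (y / k), b + e * ((x / k : ℤ) + (y / k : ℤ) * I) -
      (τ.prototile (f (x / k) (y / k))).corner), exists_mem_gridTiles _ _ hZ,
      (t.1, τ.factor * (τ.prototile (f (x / k) (y / k))).corner + e *
        ((x : ZMod k).val + (y : ZMod k).val * I) - (τ.prototile t.1).corner), ?_, ?_⟩
    · rw [hS.mem_rule]
      refine ⟨x, y, h1, ?_⟩
      rw [hf _ _ hZ]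
      exact add_sub_cancel _ _
    · refine Tile.ext_of_corner (α := τ.prototile) rfl ?_
      rw [h2]
      simp only [place, Square.shift]
      nth_rewrite 1 [← hval x, ← hval y]
      rw [hθ]
      ring

/-- Each rule covers exactly its stretched prototile. This is what shows that the higher members of
a hierarchy, not assumed to be tilings of the plane, cover it as well. -/
lemma support_decompose (T : Set (Tile ι)) : support τ.prototile (τ.decompose T) =
    (fun z : ℂ => (τ.factor : ℂ) * z) '' support τ.prototile T := by
  have hplace : ∀ (p : Tile ι) (w : ℂ), w ∈ (place τ.prototile p).region ↔
      w - p.2 ∈ (τ.prototile p.1).region := by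
    intro p w
    rw [Square.mem_region, Square.mem_region]
    simp only [Square.coord, place, Square.shift, sub_sub, add_comm]
  have hθ : (τ.factor : ℂ) ≠ 0 := by
    exact_mod_cast (one_pos.trans τ.one_lt_factor).ne'
  ext w
  simp only [support, Set.mem_iUnion, exists_prop, Set.mem_image]
  constructor
  · rintro ⟨t, ⟨p, hp, q, hq, rfl⟩, hw⟩
    rw [hplace] at hw
    have : w - τ.factor * p.2 ∈ support τ.prototile (τ.rule p.1) := by
      simp only [support, Set.mem_iUnion, exists_prop]
      exact ⟨q, hq, (hplace _ _).2 (by rwa [sub_right_comm, sub_sub])⟩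
    rw [τ.rule_support] at this
    obtain ⟨z, hz, hzw⟩ := this
    refine ⟨z + p.2, ⟨p, hp, (hplace _ _).2 (by rwa [add_sub_cancel_right])⟩, ?_⟩
    simp only at hzw
    rw [mul_add, hzw, sub_add_cancel]
  · rintro ⟨z, ⟨p, hp, hz⟩, rfl⟩
    rw [hplace] at hz
    have : (τ.factor : ℂ) * (z - p.2) ∈ support τ.prototile (τ.rule p.1) := by
      rw [τ.rule_support]
      exact ⟨_, hz, rfl⟩
    simp only [support, Set.mem_iUnion, exists_prop] at this
    obtain ⟨q, hq, hw⟩ := this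
    refine ⟨_, ⟨p, hp, q, hq, rfl⟩, (hplace _ _).2 ?_⟩
    rw [hplace] at hw
    rwa [mul_sub, sub_sub, add_comm] at hw

theorem Substitution.IsLattice.isHierarchical_iff (hS : τ.IsLattice k S)
    (hα : ∀ i j, (τ.prototile i).sideLength = (τ.prototile j).sideLength) (T : Set (Tile ι)) :
    τ.IsHierarchical T ↔ ∃ (b e : ℂ) (f : ℤ → ℤ → ι),
      HasHierarchy S (fun _ _ => True) (fun _ _ => True) f ∧
        (∀ x y, (τ.prototile (f x y)).edge = e) ∧ T = gridTiles τ.prototile b e Set.univ f := by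
  have hθ : (τ.factor : ℂ) ≠ 0 := by
    exact_mod_cast (one_pos.trans τ.one_lt_factor).ne'
  constructor
  · rintro ⟨hT, 𝒯, rfl, h⟩
    have hsupp : ∀ n, support τ.prototile (𝒯 n) = Set.univ := by
      intro n
      induction n with
      | zero => exact hT.2
      | succ n ih =>
        rw [← (h n).2.2, support_decompose] at ih
        refine Set.eq_univ_of_forall fun w => ?_
        obtain ⟨z, hz, hzw⟩ := ih.symm ▸ Set.mem_univ ((τ.factor : ℂ) * w)
        rwa [← mul_left_cancel₀ hθ hzw]
    choose b e f he hf using fun n =>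
      IsPlaneTiling.exists_grid hα ⟨(h n).1, hsupp n⟩ (h n).2.1
    have hstep : ∀ n, ∃ p q : ℤ, IsComposition S (f (n + 1)) (f n) p q := by
      intro n
      have h1 := (h n).2.2
      rw [hf n, hf (n + 1), hS.decompose_gridTiles fun x y _ => he (n + 1) x y] at h1
      obtain ⟨-, p, q, -, h2⟩ := gridTiles_subset (fun x y _ => he n x y)
        (fun x y _ => hS.substitute_edge (he (n + 1) _ _)) (Set.mem_univ _) h1.superset
      exact ⟨p, q, fun x y => (h2 x y trivial).2⟩
    choose p q hpq using hstep
    exact ⟨b 0, e 0, f 0, ⟨f, p, q, rfl, hpq, fun _ _ _ => ⟨trivial, trivial⟩⟩, he 0, hf 0⟩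
  · rintro ⟨b, e, f, ⟨F, p, q, rfl, hF, -⟩, he, rfl⟩
    have he' : ∀ n x y, (τ.prototile (F n x y)).edge = e := by
      intro n
      induction n with
      | zero => exact he
      | succ n ih =>
        intro X Y
        rw [← ih (k * X - p n) (k * Y - q n), hF n, hS.edge, blockStart_ediv, blockStart_ediv]
    -- The origins of the successive lattices: stretching and then translating by the offset of
    -- order `n` must return the previous origin, as `hB` records.
    let B : ℕ → ℂ := fun n => Nat.rec b (fun n c => (c - e * (p n + q n * I)) / τ.factor) n
    have hB : ∀ n, τ.factor * B (n + 1) + e * (p n + q n * I) = B n := fun n => by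
      show (τ.factor : ℂ) * ((B n - e * (p n + q n * I)) / τ.factor) + e * (p n + q n * I) = B n
      rw [mul_div_cancel₀ _ hθ, sub_add_cancel]
    refine ⟨⟨gridTiles_isTiling fun x y _ => he x y, gridTiles_support he⟩,
      fun n => gridTiles τ.prototile (B n) e Set.univ (F n), rfl, fun n =>
        ⟨gridTiles_isTiling fun x y _ => he' n x y, gridTiles_sideToSide fun x y _ => he' n x y,
          ?_⟩⟩
    rw [hS.decompose_gridTiles fun x y _ => he' (n + 1) x y, gridTiles_translate (p n) (q n), hB]
    have : F n = fun x y => substitute S (F (n + 1)) (x + p n) (y + q n) := by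
      funext x y
      exact hF n x y
    change _ = gridTiles τ.prototile (B n) e Set.univ (F n)
    rw [this]
    rfl

/-- Supertiles are parts of lattice tilings. -/
lemma Substitution.IsLattice.iterate_decompose (hS : τ.IsLattice k S) (n : ℕ) (t : Tile ι) :
    (∀ x y, (τ.prototile (superField S n t.1 x y)).edge = (τ.prototile t.1).edge) ∧
      τ.decompose^[n] {t} = gridTiles τ.prototile (τ.factor ^ n * (place τ.prototile t).corner)
        (τ.prototile t.1).edge {z | z.1 / (k : ℤ) ^ n = 0 ∧ z.2 / (k : ℤ) ^ n = 0}
        (superField S n t.1) := by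
  induction n with
  | zero =>
    refine ⟨fun _ _ => rfl, Set.ext fun s => ⟨?_, ?_⟩⟩
    · rintro rfl
      exact ⟨0, 0, by simp, rfl, by simp⟩
    · rintro ⟨x, y, ⟨h1, h2⟩, h3, h4⟩
      simp only [pow_zero, Int.ediv_one] at h1 h2
      exact Tile.ext_of_corner (α := τ.prototile) h3 (by rw [h4, h1, h2]; simp)
  | succ n ih =>
    obtain ⟨h1, h2⟩ := ih
    have hsucc : superField S (n + 1) t.1 = substitute S (superField S n t.1) :=
      Function.iterate_succ_apply' _ _ _
    have hpow : ∀ x : ℤ, x / (k : ℤ) / (k : ℤ) ^ n = x / (k : ℤ) ^ (n + 1) := by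
      intro x
      rw [Int.ediv_ediv_of_nonneg (Int.natCast_nonneg k), pow_succ']
    refine ⟨fun x y => ?_, ?_⟩
    · rw [hsucc]
      exact hS.substitute_edge (h1 _ _)
    · rw [Function.iterate_succ_apply', h2, hS.decompose_gridTiles fun x y _ => h1 x y, hsucc,
        ← mul_assoc, ← pow_succ']
      simp only [Set.mem_ofPred_eq, hpow]

theorem Substitution.IsLattice.isSubstitutionTiling_iff (hS : τ.IsLattice k S)
    (hα : ∀ i j, (τ.prototile i).sideLength = (τ.prototile j).sideLength) (T : Set (Tile ι)) :
    τ.IsSubstitutionTiling T ↔ ∃ (b e : ℂ) (f : ℤ → ℤ → ι), IsSubstitutive S f ∧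
        (∀ x y, (τ.prototile (f x y)).edge = e) ∧ T = gridTiles τ.prototile b e Set.univ f := by
  have hθ : (τ.factor : ℂ) ≠ 0 := by
    exact_mod_cast (one_pos.trans τ.one_lt_factor).ne'
  constructor
  · rintro ⟨hT, hfin⟩
    -- Any two tiles lie in a common supertile, which is part of a lattice tiling.
    have hside : SideToSide τ.prototile T := by
      intro s hs t ht hst j l h
      obtain ⟨_, ⟨n, t₀, rfl⟩, hsub⟩ := hfin {s, t} (Set.pair_subset hs ht) (Set.toFinite _)
      obtain ⟨h1, h2⟩ := hS.iterate_decompose n t₀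
      rw [h2] at hsub
      exact gridTiles_sideToSide (fun x y _ => h1 x y) s (hsub (by simp)) t (hsub (by simp)) hst
        j l h
    obtain ⟨b, e, f, he, rfl⟩ := hT.exists_grid hα hside
    refine ⟨b, e, f, fun N => ?_, he, rfl⟩
    set Z : Set (ℤ × ℤ) := {z | |z.1| ≤ N ∧ |z.2| ≤ N} with hZ
    have hZfin : Z.Finite :=
      ((Set.finite_Icc (-N : ℤ) N).prod (Set.finite_Icc (-N : ℤ) N)).subset
        fun z hz => ⟨abs_le.1 hz.1, abs_le.1 hz.2⟩
    have hsubset : gridTiles τ.prototile b e Z f ⊆ gridTiles τ.prototile b e Set.univ f := by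
      rintro t ⟨x, y, -, h⟩
      exact ⟨x, y, trivial, h⟩
    have hfinite : (gridTiles τ.prototile b e Z f).Finite := by
      refine (hZfin.image fun z : ℤ × ℤ => ((f z.1 z.2, b + e * (z.1 + z.2 * I) -
        (τ.prototile (f z.1 z.2)).corner) : Tile ι)).subset ?_
      rintro t ⟨x, y, hxy, h1, h2⟩
      exact ⟨(x, y), hxy, Tile.ext_of_corner (α := τ.prototile) h1.symm
        ((add_sub_cancel _ _).trans h2.symm)⟩
    obtain ⟨_, ⟨n, t, rfl⟩, hsub⟩ := hfin _ hsubset hfinite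
    obtain ⟨h1, h2⟩ := hS.iterate_decompose n t
    rw [h2] at hsub
    obtain ⟨-, p, q, -, h3⟩ := gridTiles_subset (fun x y _ => he x y) (fun x y _ => h1 x y)
      (by simp [hZ]) hsub
    refine ⟨n, t.1, p, q, fun x y hx hy => ?_⟩
    obtain ⟨⟨h4, h5⟩, h6⟩ := h3 x y ⟨hx, hy⟩
    exact ⟨h4, h5, h6⟩
  · rintro ⟨b, e, f, hf, he, rfl⟩
    refine ⟨⟨gridTiles_isTiling fun x y _ => he x y, gridTiles_support he⟩, fun P hP hPfin => ?_⟩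
    have hP' : ∀ t ∈ P, ∃ x y : ℤ, t.1 = f x y ∧
        (place τ.prototile t).corner = b + e * (x + y * I) := fun t ht => by
      obtain ⟨x, y, -, h⟩ := hP ht
      exact ⟨x, y, h⟩
    choose! x y h1 h2 using hP'
    obtain ⟨N, hN⟩ := (hPfin.image fun t => (x t).natAbs + (y t).natAbs).bddAbove
    obtain ⟨n, t, p, q, h⟩ := hf N
    have hpow : (τ.factor : ℂ) ^ n ≠ 0 := pow_ne_zero _ hθ
    -- The shift is chosen so that the corner of `t₀`, stretched `n` times, is the lattice point
    -- `(-p, -q)` of the given tiling.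
    set t₀ : Tile ι := (t, (b - e * (p + q * I)) / τ.factor ^ n - (τ.prototile t).corner) with ht₀
    obtain ⟨h3, h4⟩ := hS.iterate_decompose n t₀
    have hedge : (τ.prototile t).edge = e := by
      rw [← he 0 0, (h 0 0 (by simp) (by simp)).2.2]
      exact (h3 _ _).symm
    refine ⟨_, ⟨n, t₀, rfl⟩, fun s hs => ?_⟩
    have hle : (x s).natAbs + (y s).natAbs ≤ N := hN (Set.mem_image_of_mem _ hs)
    obtain ⟨h5, h6, h7⟩ := h (x s) (y s) (by rw [Int.abs_eq_natAbs]; omega)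
      (by rw [Int.abs_eq_natAbs]; omega)
    rw [h4]
    refine ⟨x s + p, y s + q, ⟨h5, h6⟩, (h1 s hs).trans h7, ?_⟩
    have hc : (place τ.prototile t₀).corner = (b - e * (p + q * I)) / τ.factor ^ n :=
      add_sub_cancel _ _
    rw [h2 s hs, hc, mul_div_cancel₀ _ hpow, hedge]
    push_cast
    ring

end Reduction

/-- Without prototiles there is no rule from which to obtain `k`, but also no tiling of the plane.
-/
lemma isSofic_of_isEmpty {ι : Type*} [IsEmpty ι] {α : ι → Square} {F : Set (Set (Tile ι))}
    (hF : ∀ T ∈ F, IsPlaneTiling α T) : IsSofic α F := by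
  have hno : ∀ {κ : Type _} [IsEmpty κ] {β : κ → Square} (T : Set (Tile κ)),
      ¬ IsPlaneTiling β T := by
    intro κ _ β T hT
    have : (0 : ℂ) ∈ support β T := by rw [hT.2]; trivial
    simp only [support, Set.mem_iUnion, exists_prop] at this
    obtain ⟨t, -⟩ := this
    exact isEmptyElim t.1
  exact ⟨Unit, inferInstance, ∅, fun T =>
    ⟨fun h => absurd (hF T h) (hno T), fun ⟨T', h, _⟩ => absurd h.planeTiling (hno T')⟩⟩

end SquareTiling

theorem theorem2p1 {M : ℕ} (τ : SquareTiling.Substitution (Fin M))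
    (hsize : ∀ i j : Fin M, (τ.prototile i).sideLength = (τ.prototile j).sideLength) :
    SquareTiling.IsSofic τ.prototile {T | τ.IsHierarchical T} ∧
      SquareTiling.IsSofic τ.prototile {T | τ.IsSubstitutionTiling T} := by
  open SquareTiling in
  rcases isEmpty_or_nonempty (Fin M) with _ | _
  · exact ⟨isSofic_of_isEmpty fun T hT => hT.1, isSofic_of_isEmpty fun T hT => hT.1⟩
  obtain ⟨k, hk, S, hS⟩ := τ.exists_isLattice hsize
  have : Fact (1 < k) := ⟨hk⟩
  have : NeZero k := ⟨by omega⟩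
  constructor
  · refine isSofic_of_localRule hsize
      (LocalRule S (fun _ _ => True) (fun _ _ => True)) (Cell.form S) fun T => ?_
    rw [Set.mem_ofPred_eq, hS.isHierarchical_iff hsize]
    constructor
    · rintro ⟨b, e, f, hf, he, rfl⟩
      obtain ⟨σ, hσ, h⟩ := hasHierarchy_iff.1 hf
      exact ⟨b, e, σ, hσ, fun x y => by rw [h, he], by simp only [h]⟩
    · rintro ⟨b, e, σ, hσ, he, rfl⟩
      exact ⟨b, e, _, hasHierarchy_iff.2 ⟨σ, hσ, fun _ _ => rfl⟩, he, rfl⟩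
  -- The labels are now `2 × 2` patterns; the form of a tile is the lower left entry of its pattern.
  · refine isSofic_of_localRule hsize
      (LocalRule (patternSubst S) (patternH S) patternV)
      (fun s => s.form (patternSubst S) false false) fun T => ?_
    rw [Set.mem_ofPred_eq, hS.isSubstitutionTiling_iff hsize]
    constructor
    · rintro ⟨b, e, f, hf, he, rfl⟩
      obtain ⟨G, hG, hGf⟩ := isSubstitutive_iff.1 hf
      obtain ⟨σ, hσ, h⟩ := hasHierarchy_iff.1 hG
      exact ⟨b, e, σ, hσ, fun x y => by rw [h, hGf, he], by simp only [h, hGf]⟩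
    · rintro ⟨b, e, σ, hσ, he, rfl⟩
      exact ⟨b, e, _, isSubstitutive_iff.2 ⟨_, hasHierarchy_iff.2 ⟨σ, hσ, fun _ _ => rfl⟩,
        fun _ _ => rfl⟩, he, rfl⟩
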